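/- Consider the word RAM with unit-cost operations on words of $W$ bits (addition, subtraction, multiplication, integer division and remainder, bitwise Boolean operations, shifts, comparisons, indirect loads and stores, and conditional branching). There are a deterministic construction program, a deterministic query program and a constant $K$ such that for every constant $c$ there is a constant $C$ with the following property. Let $\tau:\mathbb{N}\to\mathbb{N}$ satisfy $\tau(n)=o\left(\frac{\log n}{\log\log n}\right)$. Then for all sufficiently large $n$ (depending on $c$ and $\tau$), every word size $W$ with $2^W\ge Kn$, and every text $T$ of length $n$ whose letters are non-negative integers smaller than $\min(n^{c},2^W)$: (i) given $T$, $n$ and $\tau=\tau(n)$, the construction program builds in time at most $Cn$ a data structure that consists of at most $C\,\frac{n\log \tau}{\log n}$ machine words; (ii) given only this data structure and indices $1\le \ell\le r\le n$ with $r-\ell+1\le\tau$, the query program returns, in time at most $C$ and without changing the memory, the length of the lexicographically smallest non-empty suffix of the fragment $T[\ell..r]$. -/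

import Mathlib

/-! ### The word RAM

Words of a machine with word size `W` are the natural numbers below `2 ^ W`. The memory is an array
of words addressed by words; in addition there are registers, of which a program uses only the
finitely many that it names. Every instruction and every test of a register costs one time unit.
A program is a fixed finite object: it depends neither on `W` nor on the input. -/

namespace WordRAM

/-- The binary operations of the machine. -/
inductive Op
  | add | sub | mul | div | mod | and | or | xor | shl | shr | lt | eq

/-- The result of an operation on two words. Arithmetic is modulo `2 ^ W`, comparisons return
`0` or `1`. -/
def Op.eval (W : ℕ) : Op → ℕ → ℕ → ℕ
  | .add, a, b => (a + b) % 2 ^ W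
  | .sub, a, b => (2 ^ W + a - b) % 2 ^ W
  | .mul, a, b => (a * b) % 2 ^ W
  | .div, a, b => a / b
  | .mod, a, b => a % b
  | .and, a, b => a &&& b
  | .or, a, b => a ||| b
  | .xor, a, b => a ^^^ b
  | .shl, a, b => (a * 2 ^ b) % 2 ^ W
  | .shr, a, b => a / 2 ^ b
  | .lt, a, b => if a < b then 1 else 0
  | .eq, a, b => if a = b then 1 else 0

/-- Elementary instructions; `d`, `a`, `b` are names of registers. -/
inductive Instr
  /-- `d := k` -/
  | const (d k : ℕ)
  /-- `d := a o b` -/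
  | op (o : Op) (d a b : ℕ)
  /-- `d := mem[a]` -/
  | load (d a : ℕ)
  /-- `mem[a] := b` -/
  | store (a b : ℕ)

/-- The contents of the registers and of the memory. -/
structure State where
  regs : ℕ → ℕ
  mem : ℕ → ℕ

/-- The effect of one elementary instruction. -/
def Instr.exec (W : ℕ) : Instr → State → State
  | .const d k, s => ⟨Function.update s.regs d (k % 2 ^ W), s.mem⟩
  | .op o d a b, s => ⟨Function.update s.regs d (o.eval W (s.regs a) (s.regs b)), s.mem⟩
  | .load d a, s => ⟨Function.update s.regs d (s.mem (s.regs a)), s.mem⟩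
  | .store a b, s => ⟨s.regs, Function.update s.mem (s.regs a) (s.regs b)⟩

/-- Programs: elementary instructions, sequencing, branching on whether the register `r` is
nonzero, and iteration as long as the register `r` is nonzero. -/
inductive Prog
  | instr (i : Instr)
  | seq (p q : Prog)
  | ite (r : ℕ) (p q : Prog)
  | while (r : ℕ) (p : Prog)

/-- `Exec W p s s' t`: on a machine with word size `W`, the program `p` started in the state `s`
halts in the state `s'` after exactly `t` time units. -/
inductive Exec (W : ℕ) : Prog → State → State → ℕ → Prop
  | instr (i : Instr) (s : State) : Exec W (.instr i) s (i.exec W s) 1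
  | seq {p q : Prog} {s₁ s₂ s₃ : State} {t u : ℕ} :
      Exec W p s₁ s₂ t → Exec W q s₂ s₃ u → Exec W (.seq p q) s₁ s₃ (t + u)
  | ite_nonzero {r : ℕ} {p q : Prog} {s s' : State} {t : ℕ} :
      s.regs r ≠ 0 → Exec W p s s' t → Exec W (.ite r p q) s s' (t + 1)
  | ite_zero {r : ℕ} {p q : Prog} {s s' : State} {t : ℕ} :
      s.regs r = 0 → Exec W q s s' t → Exec W (.ite r p q) s s' (t + 1)
  | while_zero {r : ℕ} {p : Prog} {s : State} :
      s.regs r = 0 → Exec W (.while r p) s s 1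
  | while_nonzero {r : ℕ} {p : Prog} {s₁ s₂ s₃ : State} {t u : ℕ} :
      s₁.regs r ≠ 0 → Exec W p s₁ s₂ t → Exec W (.while r p) s₂ s₃ u →
      Exec W (.while r p) s₁ s₃ (t + u + 1)

/-- Registers `0` and `1` hold `x` and `y`, all other registers hold `0`. -/
def inputRegs (x y : ℕ) : ℕ → ℕ
  | 0 => x
  | 1 => y
  | _ => 0

/-- The input of a construction algorithm: the text is stored in the first `|T|` memory cells, one
letter per cell, and the rest of the memory is `0`; registers `0` and `1` hold `|T|` and the
parameter `τ`. -/
def buildInput (T : List ℕ) (τ : ℕ) : State :=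
  ⟨inputRegs T.length τ, fun a => T.getD a 0⟩

end WordRAM

/-! ### Minimal suffixes -/

/-- The fragment `T[ℓ..r]`, positions being numbered from `1`. -/
def fragment (T : List ℕ) (ℓ r : ℕ) : List ℕ :=
  (T.take r).drop (ℓ - 1)

/-- `s` is the lexicographically smallest non-empty suffix of `v`. -/
def IsMinSuf (v s : List ℕ) : Prop :=
  s ≠ [] ∧ s <:+ v ∧ ∀ u : List ℕ, u ≠ [] → u <:+ v → s = u ∨ List.Lex (· < ·) s u

/-- `D` is a memory whose first `size` cells contain a data structure for the text `T`. The program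
`query`, given `ℓ` and `r` in the registers `0` and `1` and given these `size` cells (the rest of
the memory is arbitrary), returns in register `0` the length of the minimal suffix of `T[ℓ..r]`,
for every non-empty fragment of `T` of length at most `τ`. It takes at most `time` time units and
leaves the memory as it was. -/
def AnswersMinSuf (W : ℕ) (query : WordRAM.Prog) (D : ℕ → ℕ) (size : ℕ) (T : List ℕ)
    (τ time : ℕ) : Prop :=
  ∀ ℓ r : ℕ, 1 ≤ ℓ → ℓ ≤ r → r ≤ T.length → r - ℓ + 1 ≤ τ →
    ∀ M : ℕ → ℕ, (∀ a < size, M a = D a) →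
      ∃ (q : WordRAM.State) (t : ℕ),
        WordRAM.Exec W query ⟨WordRAM.inputRegs ℓ r, M⟩ q t ∧ t ≤ time ∧ q.mem = M ∧
        ∃ s : List ℕ, IsMinSuf (fragment T ℓ r) s ∧ q.regs 0 = s.length

/-! Let `t` be the least power of two with `τ ≤ t`, and cover the text by blocks of length `2 * t`
that start `t` apart. A fragment of length at most `t` lies in the block in whose first half it
starts. Its minimal suffix depends only on the relative order of the letters
(`suf_lt_suf_iff_of_orderIso`), so each letter may be replaced by its rank within the block. Ranks
are at most `2 * t`, hence take `w` bits where `2 ^ w = 4 * t`, and a block becomes an identifier of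
`2 * t * w = O(τ log τ)` bits. Put `M = 2 ^ (2 * t * w)`. The growth condition on `τ` is what yields
`M ^ 4 ≤ n` for large `n` (`eventually_pow_le`).

This has two consequences. A table of the answers for all triples (identifier, first offset, last
offset) has `M * (2 * t) ^ 2` entries; computing each of them by brute force in time `O(t ^ 2)`
costs `O(M ^ 2) = O(√n)` altogether (`runs_entry`, `Params.table_le`). Moreover `g` identifiers fit
into one word, where `M ^ g ≤ n < M ^ (g + 1)`; as `t * w * g` is of order `log n`, about `n / (t *
g) = O(n * w / log n)` words suffice, and `w = O(log τ)` (`Params.cast_size_le`). A query extracts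
one identifier by a shift and a remainder and looks up one table entry (`runs_query`).

The ranks are found in linear time. Radix sort in base `n` orders the positions by letter
(`runs_sort`); the program does not know `c`, but stops when no letter has a further nonzero digit.
A sweep through the sorted positions then adds each position to the two blocks that contain it; its
rank is a counter of the block that grows whenever the letter differs from the preceding one of that
block (`Ranked.insert`, `runs_sweep`).

For `τ < 2` the bound on the size is `0`, so nothing may be stored; all fragments are then single
letters, and the answer is `1`.

The programs are verified in a small language with exact arithmetic; `Eval.exec_compile` transfers
termination, result and running time to the machine. -/

/-! ### A structured language with arrays

A small imperative language over variables and finitely many arrays of a common length `len`, with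
exact arithmetic on natural numbers and explicit no-overflow conditions. Programs of this language
are compiled to word RAM programs: array `k` occupies the cells `k * len, …, k * len + len - 1`. -/

namespace ArrayLang

open WordRAM

/-- The value of an operation in exact arithmetic. -/
def exactValue : Op → ℕ → ℕ → ℕ
  | .add, a, b => a + b
  | .sub, a, b => a - b
  | .mul, a, b => a * b
  | .div, a, b => a / b
  | .mod, a, b => a % b
  | .and, a, b => a &&& b
  | .or, a, b => a ||| b
  | .xor, a, b => a ^^^ b
  | .shl, a, b => a * 2 ^ b
  | .shr, a, b => a / 2 ^ b
  | .lt, a, b => if a < b then 1 else 0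
  | .eq, a, b => if a = b then 1 else 0

/-- A condition under which the machine computes the exact value. -/
def Fits (W : ℕ) : Op → ℕ → ℕ → Prop
  | .add, a, b => a + b < 2 ^ W
  | .sub, a, b => b ≤ a ∧ a < 2 ^ W
  | .mul, a, b => a * b < 2 ^ W
  | .shl, a, b => a * 2 ^ b < 2 ^ W
  | _, _, _ => True

theorem eval_eq_exactValue {W : ℕ} {o : Op} {a b : ℕ} (h : Fits W o a b) :
    o.eval W a b = exactValue o a b := by
  cases o <;> simp only [Op.eval, exactValue, Fits] at *
  case sub =>
    rw [Nat.add_sub_assoc h.1, Nat.add_mod_left, Nat.mod_eq_of_lt (by omega)]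
  all_goals exact Nat.mod_eq_of_lt h

/-- Expressions: variables, literals, operations and array accesses. -/
inductive Exp
  | var (x : ℕ)
  | lit (k : ℕ)
  | bin (o : Op) (a b : Exp)
  | get (k : ℕ) (i : Exp)

/-- Commands. -/
inductive Cmd
  | skip
  | asg (x : ℕ) (e : Exp)
  | put (k : ℕ) (i e : Exp)
  | seq (p q : Cmd)
  | ite (e : Exp) (p q : Cmd)
  | while (e : Exp) (p : Cmd)

infixr:30 ";;" => Cmd.seq

/-- The values of the variables and the contents of the arrays. -/
structure Env where
  v : ℕ → ℕ
  arr : ℕ → ℕ → ℕ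

/-- Assign a value to a variable. -/
def Env.set (s : Env) (x a : ℕ) : Env := ⟨fun y => if y = x then a else s.v y, s.arr⟩

/-- Write a value to a cell of an array. -/
def Env.write (s : Env) (k i a : ℕ) : Env :=
  ⟨s.v, fun l => if l = k then fun j => if j = i then a else s.arr k j else s.arr l⟩

@[simp] theorem Env.set_v (s : Env) (x a y : ℕ) :
    (s.set x a).v y = if y = x then a else s.v y := rfl

@[simp] theorem Env.set_arr (s : Env) (x a : ℕ) : (s.set x a).arr = s.arr := rfl

@[simp] theorem Env.write_v (s : Env) (k i a : ℕ) : (s.write k i a).v = s.v := rfl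

@[simp] theorem Env.write_arr (s : Env) (k i a l : ℕ) : (s.write k i a).arr l =
    if l = k then fun j => if j = i then a else s.arr k j else s.arr l := rfl

/-- The value of an expression. -/
def Exp.eval (s : Env) : Exp → ℕ
  | .var x => s.v x
  | .lit k => k
  | .bin o a b => exactValue o (a.eval s) (b.eval s)
  | .get k i => s.arr k (i.eval s)

/-- The number of instructions that evaluate an expression. -/
def Exp.cost : Exp → ℕ
  | .var _ => 1
  | .lit _ => 1
  | .bin _ a b => a.cost + b.cost + 1
  | .get _ i => i.cost + 2

/-- Dimensions of the machine: word size, number of arrays and their length. -/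
structure Dims where
  W : ℕ
  m : ℕ
  len : ℕ

/-- No operation overflows and all array accesses are within bounds. -/
def Exp.Safe (D : Dims) (s : Env) : Exp → Prop
  | .var _ => True
  | .lit k => k < 2 ^ D.W
  | .bin o a b => a.Safe D s ∧ b.Safe D s ∧ Fits D.W o (a.eval s) (b.eval s)
  | .get k i => i.Safe D s ∧ k < D.m ∧ i.eval s < D.len

/-- `Eval D p s s' t`: the command `p` takes the environment `s` to `s'` in time `t`. -/
inductive Eval (D : Dims) : Cmd → Env → Env → ℕ → Prop
  | skip (s : Env) : Eval D .skip s s 1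
  | asg {s : Env} {x : ℕ} {e : Exp} : e.Safe D s →
      Eval D (.asg x e) s (s.set x (e.eval s)) (e.cost + 1)
  | put {s : Env} {k : ℕ} {i e : Exp} : i.Safe D s → e.Safe D s → k < D.m → i.eval s < D.len →
      Eval D (.put k i e) s (s.write k (i.eval s) (e.eval s)) (i.cost + e.cost + 2)
  | seq {p q : Cmd} {s₁ s₂ s₃ : Env} {t u : ℕ} :
      Eval D p s₁ s₂ t → Eval D q s₂ s₃ u → Eval D (.seq p q) s₁ s₃ (t + u)
  | ite_nonzero {e : Exp} {p q : Cmd} {s s' : Env} {t : ℕ} : e.Safe D s → e.eval s ≠ 0 →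
      Eval D p s s' t → Eval D (.ite e p q) s s' (e.cost + (t + 1))
  | ite_zero {e : Exp} {p q : Cmd} {s s' : Env} {t : ℕ} : e.Safe D s → e.eval s = 0 →
      Eval D q s s' t → Eval D (.ite e p q) s s' (e.cost + (t + 1))
  | while_zero {e : Exp} {p : Cmd} {s : Env} : e.Safe D s → e.eval s = 0 →
      Eval D (.while e p) s s (e.cost + 1)
  | while_nonzero {e : Exp} {p : Cmd} {s₁ s₂ s₃ : Env} {t u : ℕ} : e.Safe D s₁ → e.eval s₁ ≠ 0 →
      Eval D p s₁ s₂ t → Eval D (.while e p) s₂ s₃ u →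
      Eval D (.while e p) s₁ s₃ (e.cost + (t + u + 1))

/-! ### Compilation -/

/-- All variables of an expression have indices below `100`. -/
def Exp.WF : Exp → Bool
  | .var x => decide (x < 100)
  | .lit _ => true
  | .bin _ a b => a.WF && b.WF
  | .get _ i => i.WF

/-- All variables of a command have indices below `100`. -/
def Cmd.WF : Cmd → Bool
  | .skip => true
  | .asg x e => decide (x < 100) && e.WF
  | .put _ i e => i.WF && e.WF
  | .seq p q => p.WF && q.WF
  | .ite e p q => e.WF && p.WF && q.WF
  | .while e p => e.WF && p.WF

/-- Instructions that leave the value of an expression in register `d` and change no register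
below `d`. Register `100 + k` holds the address of array `k`. -/
def Exp.compile (d : ℕ) : Exp → Prog
  | .var x => .instr (.op .or d x x)
  | .lit k => .instr (.const d k)
  | .bin o a b => .seq (.seq (a.compile d) (b.compile (d + 1))) (.instr (.op o d d (d + 1)))
  | .get k i => .seq (.seq (i.compile d) (.instr (.op .add d d (100 + k)))) (.instr (.load d d))

/-- The word RAM program of a command. -/
def Cmd.compile : Cmd → Prog
  | .skip => .instr (.const 200 0)
  | .asg x e => .seq (e.compile 200) (.instr (.op .or x 200 200))
  | .put k i e => .seq (.seq (.seq (i.compile 200) (.instr (.op .add 200 200 (100 + k))))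
      (e.compile 201)) (.instr (.store 200 201))
  | .seq p q => .seq p.compile q.compile
  | .ite e p q => .seq (e.compile 200) (.ite 200 p.compile q.compile)
  | .while e p => .seq (e.compile 200) (.while 200 (.seq p.compile (e.compile 200)))

/-- The machine state `z` represents the environment `s`. -/
structure Represents (D : Dims) (z : State) (s : Env) : Prop where
  var : ∀ x < 100, z.regs x = s.v x
  base : ∀ k < D.m, z.regs (100 + k) = k * D.len
  arr : ∀ k < D.m, ∀ i < D.len, z.mem (k * D.len + i) = s.arr k i

theorem Represents.congr {D : Dims} {z z' : State} {s : Env} (h : Represents D z s) (hm : D.m ≤ 100)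
    (hr : ∀ x < 200, z'.regs x = z.regs x) (hz : z'.mem = z.mem) : Represents D z' s where
  var x hx := by rw [hr x (by omega), h.var x hx]
  base k hk := by rw [hr _ (by omega), h.base k hk]
  arr k hk i hi := by rw [hz, h.arr k hk i hi]

theorem addr_lt {D : Dims} (hD : D.m * D.len ≤ 2 ^ D.W) {k i : ℕ} (hk : k < D.m) (hi : i < D.len) :
    k * D.len + i < 2 ^ D.W := by
  have : (k + 1) * D.len ≤ D.m * D.len := Nat.mul_le_mul_right _ hk
  nlinarith

theorem addr_inj {len k i l j : ℕ} (hi : i < len) (hj : j < len)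
    (h : k * len + i = l * len + j) : k = l ∧ i = j := by
  have h1 : (k * len + i) / len = k := by
    rw [add_comm, Nat.add_mul_div_right _ _ (by omega), Nat.div_eq_of_lt hi, zero_add]
  have h2 : (l * len + j) / len = l := by
    rw [add_comm, Nat.add_mul_div_right _ _ (by omega), Nat.div_eq_of_lt hj, zero_add]
  have : k = l := by rw [← h1, h, h2]
  subst this
  exact ⟨rfl, by omega⟩

/-- The registers from `200` on act as an evaluation stack: the second operand is computed at `d +
1` and so cannot destroy the first one at `d`. Hence the induction runs over all `d`. At most `100`
arrays are allowed, so that the base registers stay below the stack. -/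
theorem Exp.exec_compile {D : Dims} (hm : D.m ≤ 100) (hD : D.m * D.len ≤ 2 ^ D.W) {s : Env}
    (e : Exp) : ∀ (d : ℕ) (z : State), 200 ≤ d → e.WF = true → e.Safe D s → Represents D z s →
      ∃ z', Exec D.W (e.compile d) z z' e.cost ∧ z'.mem = z.mem ∧ z'.regs d = e.eval s ∧
        ∀ x < d, z'.regs x = z.regs x := by
  induction e with
  | var x =>
    intro d z hd hw _ hz
    refine ⟨_, Exec.instr _ _, rfl, ?_, ?_⟩
    · simp [Instr.exec, Op.eval, Exp.eval, hz.var x (by simpa [Exp.WF] using hw)]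
    · intro y hy
      simp [Instr.exec, Function.update_of_ne (Nat.ne_of_lt hy)]
  | lit k =>
    intro d z hd _ hs hz
    refine ⟨_, Exec.instr _ _, rfl, ?_, ?_⟩
    · simpa [Instr.exec, Exp.eval] using Nat.mod_eq_of_lt hs
    · intro y hy
      simp [Instr.exec, Function.update_of_ne (Nat.ne_of_lt hy)]
  | bin o a b iha ihb =>
    intro d z hd hw hs hz
    simp only [Exp.WF, Bool.and_eq_true] at hw
    obtain ⟨z1, e1, m1, v1, f1⟩ := iha d z hd hw.1 hs.1 hz
    have hz1 : Represents D z1 s := hz.congr hm (fun x hx => f1 x (by omega)) m1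
    obtain ⟨z2, e2, m2, v2, f2⟩ := ihb (d + 1) z1 (by omega) hw.2 hs.2.1 hz1
    refine ⟨_, Exec.seq (Exec.seq e1 e2) (Exec.instr _ _), ?_, ?_, ?_⟩
    · simp [Instr.exec, m2, m1]
    · simp only [Instr.exec, Function.update_self, Exp.eval]
      rw [v2, f2 d (by omega), v1, eval_eq_exactValue hs.2.2]
    · intro y hy
      simp only [Instr.exec, Function.update_of_ne (Nat.ne_of_lt hy)]
      rw [f2 y (by omega), f1 y hy]
  | get k i ih =>
    intro d z hd hw hs hz
    obtain ⟨z1, e1, m1, v1, f1⟩ := ih d z hd hw hs.1 hz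
    have hz1 : Represents D z1 s := hz.congr hm (fun x hx => f1 x (by omega)) m1
    have hk := hs.2.1
    have ht : (Exp.get k i).cost = i.cost + 1 + 1 := rfl
    rw [ht]
    refine ⟨_, Exec.seq (Exec.seq e1 (Exec.instr _ _)) (Exec.instr _ _), ?_, ?_, ?_⟩
    · simp [Instr.exec, m1]
    · simp only [Instr.exec, Function.update_self, Exp.eval, Op.eval]
      rw [v1, hz1.base k hk, add_comm, Nat.mod_eq_of_lt (addr_lt hD hk hs.2.2),
        hz1.arr k hk _ hs.2.2]
    · intro y hy
      simp only [Instr.exec, Function.update_of_ne (Nat.ne_of_lt hy)]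
      rw [f1 y hy]

/-- The time is preserved exactly, because `Exp.cost` and the time in `Eval` count the compiled
instructions. Everything proved about commands therefore holds for machine programs. -/
theorem Eval.exec_compile {D : Dims} (hm : D.m ≤ 100) (hD : D.m * D.len ≤ 2 ^ D.W) {p : Cmd}
    {s s' : Env} {t : ℕ} (h : Eval D p s s' t) : p.WF = true → ∀ z, Represents D z s →
      ∃ z', Exec D.W p.compile z z' t ∧ Represents D z' s' := by
  induction h with
  | skip s =>
    intro _ z hz
    refine ⟨_, Exec.instr _ _, hz.congr hm ?_ rfl⟩
    intro x hx
    simp [Instr.exec, Function.update_of_ne (Nat.ne_of_lt hx)]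
  | @asg s x e hs =>
    intro hw z hz
    simp only [Cmd.WF, Bool.and_eq_true, decide_eq_true_eq] at hw
    obtain ⟨z1, e1, m1, v1, f1⟩ := e.exec_compile hm hD 200 z le_rfl hw.2 hs hz
    refine ⟨_, Exec.seq e1 (Exec.instr _ _), ⟨?_, ?_, ?_⟩⟩
    · intro y hy
      by_cases hyx : y = x
      · subst hyx; simp [Instr.exec, Op.eval, v1]
      · simp [Instr.exec, hyx, f1 y (by omega), hz.var y hy]
    · intro k hk
      simp only [Instr.exec]
      rw [Function.update_of_ne (by omega), f1 _ (by omega), hz.base k hk]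
    · intro k hk i hi
      simp [Instr.exec, m1, hz.arr k hk i hi]
  | @put s k i e hi he hk hl =>
    intro hw z hz
    simp only [Cmd.WF, Bool.and_eq_true] at hw
    obtain ⟨z1, e1, m1, v1, f1⟩ := i.exec_compile hm hD 200 z le_rfl hw.1 hi hz
    have hz2 : Represents D ((Instr.op .add 200 200 (100 + k)).exec D.W z1) s := by
      refine hz.congr hm ?_ (by simp [Instr.exec, m1])
      intro x hx
      simp only [Instr.exec, Function.update_of_ne (Nat.ne_of_lt hx)]
      exact f1 x hx
    obtain ⟨z3, e3, m3, v3, f3⟩ := e.exec_compile hm hD 201 _ (by omega) hw.2 he hz2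
    have ha : z3.regs 200 = k * D.len + i.eval s := by
      rw [f3 200 (by omega)]
      simp only [Instr.exec, Function.update_self, Op.eval]
      rw [v1, f1 _ (by omega), hz.base k hk, add_comm, Nat.mod_eq_of_lt (addr_lt hD hk hl)]
    have hz3 := hz2.congr hm (fun x hx => f3 x (by omega)) m3
    have ht : i.cost + e.cost + 2 = i.cost + 1 + e.cost + 1 := by ring
    rw [ht]
    refine ⟨_, Exec.seq (Exec.seq (Exec.seq e1 (Exec.instr _ _)) e3) (Exec.instr _ _), ⟨?_, ?_, ?_⟩⟩
    · intro y hy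
      exact hz3.var y hy
    · intro l hl
      exact hz3.base l hl
    · intro l hl' j hj
      simp only [Instr.exec, ha, v3, Env.write_arr]
      by_cases hlk : l = k
      · subst hlk
        by_cases hji : j = i.eval s
        · simp [hji]
        · rw [Function.update_of_ne (by omega)]
          simpa [hji] using hz3.arr l hl' j hj
      · rw [Function.update_of_ne fun hh => hlk (addr_inj hj hl hh).1]
        simpa [hlk] using hz3.arr l hl' j hj
  | seq _ _ ihp ihq =>
    intro hw z hz
    simp only [Cmd.WF, Bool.and_eq_true] at hw
    obtain ⟨z1, e1, h1⟩ := ihp hw.1 z hz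
    obtain ⟨z2, e2, h2⟩ := ihq hw.2 z1 h1
    exact ⟨z2, Exec.seq e1 e2, h2⟩
  | @ite_nonzero e p q s s' t hs hne _ ih =>
    intro hw z hz
    simp only [Cmd.WF, Bool.and_eq_true] at hw
    obtain ⟨z1, e1, m1, v1, f1⟩ := e.exec_compile hm hD 200 z le_rfl hw.1.1 hs hz
    obtain ⟨z2, e2, h2⟩ := ih hw.1.2 z1 (hz.congr hm f1 m1)
    exact ⟨z2, Exec.seq e1 (Exec.ite_nonzero (by rwa [v1]) e2), h2⟩
  | @ite_zero e p q s s' t hs hne _ ih =>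
    intro hw z hz
    simp only [Cmd.WF, Bool.and_eq_true] at hw
    obtain ⟨z1, e1, m1, v1, f1⟩ := e.exec_compile hm hD 200 z le_rfl hw.1.1 hs hz
    obtain ⟨z2, e2, h2⟩ := ih hw.2 z1 (hz.congr hm f1 m1)
    exact ⟨z2, Exec.seq e1 (Exec.ite_zero (by rwa [v1]) e2), h2⟩
  | @while_zero e p s hs hne =>
    intro hw z hz
    simp only [Cmd.WF, Bool.and_eq_true] at hw
    obtain ⟨z1, e1, m1, v1, f1⟩ := e.exec_compile hm hD 200 z le_rfl hw.1 hs hz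
    exact ⟨z1, Exec.seq e1 (Exec.while_zero (by rwa [v1])), hz.congr hm f1 m1⟩
  | @while_nonzero e p s₁ s₂ s₃ t u hs hne _ _ ih1 ih2 =>
    intro hw z hz
    have hw' := hw
    simp only [Cmd.WF, Bool.and_eq_true] at hw'
    obtain ⟨z1, e1, m1, v1, f1⟩ := e.exec_compile hm hD 200 z le_rfl hw'.1 hs hz
    obtain ⟨z2, e2, h2⟩ := ih1 hw'.2 z1 (hz.congr hm f1 m1)
    obtain ⟨z3, e3, h3⟩ := ih2 hw z2 h2
    refine ⟨z3, ?_, h3⟩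
    -- The compiled loop evaluates its condition once before the machine loop and again at the end
    -- of each body. The run of the remaining loop is split after its first evaluation, which
    -- becomes the end of the present body.
    cases e3 with
    | seq ea eb =>
      have := Exec.seq e1 (Exec.while_nonzero (by rwa [v1]) (Exec.seq e2 ea) eb)
      rwa [add_assoc t] at this

/-! ### Total correctness with time -/

/-- `p` terminates from `s`; its final environment and its running time satisfy `Q`. -/
def Runs (D : Dims) (p : Cmd) (s : Env) (Q : Env → ℕ → Prop) : Prop :=
  ∃ s' t, Eval D p s s' t ∧ Q s' t

section rules

variable {D : Dims} {s : Env} {Q : Env → ℕ → Prop}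

theorem Runs.mono {p : Cmd} {Q' : Env → ℕ → Prop} (h : Runs D p s Q)
    (hq : ∀ s' t, Q s' t → Q' s' t) : Runs D p s Q' := by
  obtain ⟨s', t, e, h⟩ := h
  exact ⟨s', t, e, hq s' t h⟩

theorem runs_skip : Runs D .skip s Q ↔ Q s 1 := by
  constructor
  · rintro ⟨_, _, ⟨⟩, h⟩; exact h
  · exact fun h => ⟨_, _, .skip _, h⟩

theorem runs_asg {x : ℕ} {e : Exp} :
    Runs D (.asg x e) s Q ↔ e.Safe D s ∧ Q (s.set x (e.eval s)) (e.cost + 1) := by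
  constructor
  · rintro ⟨_, _, ⟨⟩, h⟩; exact ⟨by assumption, h⟩
  · exact fun h => ⟨_, _, .asg h.1, h.2⟩

theorem runs_put {k : ℕ} {i e : Exp} :
    Runs D (.put k i e) s Q ↔ i.Safe D s ∧ e.Safe D s ∧ k < D.m ∧ i.eval s < D.len ∧
      Q (s.write k (i.eval s) (e.eval s)) (i.cost + e.cost + 2) := by
  constructor
  · rintro ⟨_, _, ⟨⟩, h⟩; exact ⟨by assumption, by assumption, by assumption, by assumption, h⟩
  · exact fun h => ⟨_, _, .put h.1 h.2.1 h.2.2.1 h.2.2.2.1, h.2.2.2.2⟩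

theorem runs_seq {p q : Cmd} :
    Runs D (p ;; q) s Q ↔ Runs D p s fun s' t => Runs D q s' fun s'' u => Q s'' (t + u) := by
  constructor
  · rintro ⟨_, _, e, h⟩
    cases e with
    | seq e1 e2 => exact ⟨_, _, e1, _, _, e2, h⟩
  · rintro ⟨_, _, e1, _, _, e2, h⟩
    exact ⟨_, _, .seq e1 e2, h⟩

theorem runs_ite {e : Exp} {p q : Cmd} :
    Runs D (.ite e p q) s Q ↔ e.Safe D s ∧
      (e.eval s ≠ 0 → Runs D p s fun s' t => Q s' (e.cost + (t + 1))) ∧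
      (e.eval s = 0 → Runs D q s fun s' t => Q s' (e.cost + (t + 1))) := by
  constructor
  · rintro ⟨_, _, h, hq⟩
    cases h with
    | ite_nonzero hs hne h => exact ⟨hs, fun _ => ⟨_, _, h, hq⟩, fun h0 => absurd h0 hne⟩
    | ite_zero hs h0 h => exact ⟨hs, fun hne => absurd h0 hne, fun _ => ⟨_, _, h, hq⟩⟩
  · rintro ⟨hs, h1, h2⟩
    by_cases h0 : e.eval s = 0
    · obtain ⟨_, _, h, hq⟩ := h2 h0
      exact ⟨_, _, .ite_zero hs h0 h, hq⟩
    · obtain ⟨_, _, h, hq⟩ := h1 h0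
      exact ⟨_, _, .ite_nonzero hs h0 h, hq⟩

/-! ### What a command leaves unchanged, and the rule for loops -/

/-- The variables that a command may change. -/
def Cmd.vars : Cmd → List ℕ
  | .skip => []
  | .asg x _ => [x]
  | .put _ _ _ => []
  | .seq p q => p.vars ++ q.vars
  | .ite _ p q => p.vars ++ q.vars
  | .while _ p => p.vars

/-- The arrays that a command may change. -/
def Cmd.arrays : Cmd → List ℕ
  | .skip => []
  | .asg _ _ => []
  | .put k _ _ => [k]
  | .seq p q => p.arrays ++ q.arrays
  | .ite _ p q => p.arrays ++ q.arrays
  | .while _ p => p.arrays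

/-- The environments agree on everything that `p` cannot change. -/
structure Frame (p : Cmd) (s s' : Env) : Prop where
  v : ∀ x, x ∉ p.vars → s'.v x = s.v x
  arr : ∀ k, k ∉ p.arrays → s'.arr k = s.arr k

theorem Frame.refl (p : Cmd) (s : Env) : Frame p s s := ⟨fun _ _ => rfl, fun _ _ => rfl⟩

theorem Frame.trans {p : Cmd} {s₁ s₂ s₃ : Env} (h : Frame p s₁ s₂) (h' : Frame p s₂ s₃) :
    Frame p s₁ s₃ :=
  ⟨fun x hx => (h'.v x hx).trans (h.v x hx), fun x hx => (h'.arr x hx).trans (h.arr x hx)⟩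

theorem Frame.of_subset {p q : Cmd} {s₁ s₂ : Env} (h : Frame p s₁ s₂) (hv : p.vars ⊆ q.vars)
    (ha : p.arrays ⊆ q.arrays) : Frame q s₁ s₂ :=
  ⟨fun x hx => h.v x fun hx' => hx (hv hx'), fun x hx => h.arr x fun hx' => hx (ha hx')⟩

/-- Loop invariants need not mention variables and arrays that the loop never writes: their
preservation reduces to a decidable membership in `Cmd.vars` or `Cmd.arrays`. -/
theorem Eval.frame {p : Cmd} {s s' : Env} {t : ℕ} (h : Eval D p s s' t) : Frame p s s' := by
  induction h with
  | skip => exact Frame.refl _ _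
  | asg => exact ⟨fun x hx => by simp_all [Cmd.vars], fun _ _ => rfl⟩
  | put => exact ⟨fun _ _ => rfl, fun x hx => by simp_all [Cmd.arrays]⟩
  | seq _ _ h1 h2 =>
    exact (h1.of_subset (by simp [Cmd.vars]) (by simp [Cmd.arrays])).trans
      (h2.of_subset (by simp [Cmd.vars]) (by simp [Cmd.arrays]))
  | ite_nonzero _ _ _ h => exact h.of_subset (by simp [Cmd.vars]) (by simp [Cmd.arrays])
  | ite_zero _ _ _ h => exact h.of_subset (by simp [Cmd.vars]) (by simp [Cmd.arrays])
  | while_zero => exact Frame.refl _ _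
  | while_nonzero _ _ _ _ h1 h2 => exact Frame.trans (h1.of_subset (fun _ h => h) fun _ h => h) h2

theorem Runs.frame {p : Cmd} (h : Runs D p s Q) :
    Runs D p s fun s' t => Frame p s s' ∧ Q s' t := by
  obtain ⟨s', t, e, h⟩ := h
  exact ⟨s', t, e, e.frame, h⟩

/-- A loop with invariant `I k`, where `k` bounds the number of remaining iterations and each
iteration takes time at most `B`. -/
theorem Runs.while {e : Exp} {p : Cmd} (I : ℕ → Env → Prop) (B k₀ : ℕ) (h0 : I k₀ s)
    (hS : ∀ k s', Frame p s s' → I k s' → e.Safe D s')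
    (hI : ∀ k s', Frame p s s' → I k s' → e.eval s' ≠ 0 → ∀ R : Env → ℕ → Prop,
      (∀ j s'' t, j < k → t ≤ B → I j s'' → R s'' t) → Runs D p s' R)
    (hQ : ∀ k s' t, Frame p s s' → I k s' → e.eval s' = 0 →
      t ≤ (B + e.cost + 1) * k₀ + e.cost + 1 → Q s' t) : Runs D (.while e p) s Q := by
  suffices H : ∀ j s', Frame p s s' → I j s' → Runs D (.while e p) s'
      fun s'' t => t ≤ (B + e.cost + 1) * j + e.cost + 1 ∧ Frame p s s'' ∧
        ∃ i, I i s'' ∧ e.eval s'' = 0 by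
    refine (H k₀ s (Frame.refl _ _) h0).mono ?_
    rintro s' t ⟨ht, hf, i, hi, hz⟩
    exact hQ i s' t hf hi hz ht
  intro j
  induction j using Nat.strong_induction_on with
  | _ j ih =>
    intro s' hf hi
    have hs := hS j s' hf hi
    by_cases hz : e.eval s' = 0
    · exact ⟨s', _, .while_zero hs hz, by rw [add_assoc]; exact Nat.le_add_left _ _, hf, j, hi, hz⟩
    · obtain ⟨s₁, t₁, e₁, ht₁, i, hij, hi'⟩ := hI j s' hf hi hz
        (fun s'' t => t ≤ B ∧ ∃ i < j, I i s'') fun i s'' t hij ht hi => ⟨ht, i, hij, hi⟩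
      obtain ⟨s₂, t₂, e₂, ht₂, hf₂, hex⟩ := ih i hij s₁ (hf.trans e₁.frame) hi'
      refine ⟨s₂, _, .while_nonzero hs hz e₁ e₂, ?_, hf₂, hex⟩
      have : (B + e.cost + 1) * (i + 1) ≤ (B + e.cost + 1) * j := Nat.mul_le_mul_left _ hij
      rw [mul_add, mul_one] at this
      omega

end rules

notation "𝐯" x:max => Exp.var x
notation "𝐥" x:max => Exp.lit x
infixl:65 "+ₑ" => Exp.bin Op.add
infixl:65 "-ₑ" => Exp.bin Op.sub
infixl:70 "*ₑ" => Exp.bin Op.mul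
infixl:70 "/ₑ" => Exp.bin Op.div
infixl:70 "%ₑ" => Exp.bin Op.mod
infixl:60 "&ₑ" => Exp.bin Op.and
infixl:58 "|ₑ" => Exp.bin Op.or
infixl:75 "<<ₑ" => Exp.bin Op.shl
infixl:75 ">>ₑ" => Exp.bin Op.shr
infix:62 "<ₑ" => Exp.bin Op.lt
infix:62 "=ₑ" => Exp.bin Op.eq
infix:40 "::=" => Cmd.asg

attribute [simp] Exp.eval exactValue Exp.Safe Fits Exp.cost
attribute [simp] runs_skip runs_asg runs_put runs_seq runs_ite

theorem wordSize_ne_zero {n W : ℕ} (hW : 8 * n ≤ 2 ^ W) (hn : 0 < n) : W ≠ 0 := by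
  rintro rfl
  omega

/-! ### Radix sort -/

/-- The stable rearrangement of `L` by increasing values `f p < n`. -/
def bucketSort (n : ℕ) (f : ℕ → ℕ) (L : List ℕ) : List ℕ :=
  (List.range n).flatMap fun d => L.filter fun p => f p = d

theorem mem_bucketSort {n : ℕ} {f : ℕ → ℕ} {L : List ℕ} (hf : ∀ p ∈ L, f p < n) {p : ℕ} :
    p ∈ bucketSort n f L ↔ p ∈ L := by
  simp only [bucketSort, List.mem_flatMap, List.mem_range, List.mem_filter, decide_eq_true_eq]
  exact ⟨fun ⟨_, _, h, _⟩ => h, fun h => ⟨f p, hf p h, h, rfl⟩⟩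

theorem nodup_bucketSort {n : ℕ} {f : ℕ → ℕ} {L : List ℕ} (h : L.Nodup) :
    (bucketSort n f L).Nodup := by
  rw [bucketSort, List.nodup_flatMap]
  refine ⟨fun d _ => h.filter _, List.nodup_range.imp fun {a b} hab => ?_⟩
  simp only [Function.onFun, List.disjoint_left, List.mem_filter, decide_eq_true_eq]
  rintro p ⟨_, h1⟩ ⟨_, h2⟩
  exact hab (h1.symm.trans h2)

theorem perm_bucketSort {n : ℕ} {f : ℕ → ℕ} {L : List ℕ} (h : L.Nodup) (hf : ∀ p ∈ L, f p < n) :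
    (bucketSort n f L).Perm L :=
  (List.perm_ext_iff_of_nodup (nodup_bucketSort h) h).2 fun _ => mem_bucketSort hf

/-- One pass of the radix sort refines the order by the next digit. -/
theorem pairwise_bucketSort {n D : ℕ} {key : ℕ → ℕ} {L : List ℕ}
    (h : L.Pairwise fun p q => key p % D ≤ key q % D) :
    (bucketSort n (fun p => key p / D % n) L).Pairwise
      fun p q => key p % (D * n) ≤ key q % (D * n) := by
  rw [bucketSort, List.pairwise_flatMap]
  constructor
  · intro d _
    refine ((List.pairwise_filter.2 (h.imp fun {a b} hab => ?_)))
    intro ha hb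
    simp only [decide_eq_true_eq] at ha hb
    rw [Nat.mod_mul, Nat.mod_mul, ha, hb]
    omega
  · refine List.pairwise_lt_range.imp fun {a b} hab => ?_
    intro p hp q hq
    simp only [List.mem_filter, decide_eq_true_eq] at hp hq
    rw [Nat.mod_mul, Nat.mod_mul, hp.2, hq.2]
    rcases Nat.eq_zero_or_pos D with rfl | hD
    · simp at hp hq; omega
    · have h1 := Nat.mod_lt (key p) hD
      have : D * (a + 1) ≤ D * b := Nat.mul_le_mul_left _ hab
      rw [mul_add, mul_one] at this
      omega

/-- The list `l` is stored as a linked list with first element `h - 1`; `0` marks its end. -/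
def Chain (next : ℕ → ℕ) : ℕ → List ℕ → Prop
  | h, [] => h = 0
  | h, p :: l => h = p + 1 ∧ Chain next (next p) l

theorem Chain.congr {next next' : ℕ → ℕ} {l : List ℕ} : ∀ {h : ℕ}, Chain next h l →
    (∀ p ∈ l, next' p = next p) → Chain next' h l := by
  induction l with
  | nil => exact fun h _ => h
  | cons p l ih =>
    intro h hc hn
    refine ⟨hc.1, ?_⟩
    rw [hn p (by simp)]
    exact ih hc.2 fun q hq => hn q (by simp [hq])

/-- Distribute the positions listed in array `1` to the buckets of their digits. -/
def scatterBody : Cmd :=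
  8 ::= 𝐯 8 -ₑ 𝐥 1 ;;
  9 ::= .get 1 (𝐯 8) ;;
  10 ::= .get 0 (𝐯 9) /ₑ 𝐯 6 ;;
  11 ::= 𝐯 10 %ₑ 𝐯 0 ;;
  .put 3 (𝐯 9) (.get 2 (𝐯 11)) ;;
  .put 2 (𝐯 11) (𝐯 9 +ₑ 𝐥 1) ;;
  7 ::= 𝐯 7 |ₑ 𝐯 10 /ₑ 𝐯 0

/-- Append the buckets in the order of their digits, and empty them. -/
def collectBody : Cmd :=
  .ite (𝐯 10)
    (9 ::= 𝐯 10 -ₑ 𝐥 1 ;;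
     .put 1 (𝐯 12) (𝐯 9) ;;
     12 ::= 𝐯 12 +ₑ 𝐥 1 ;;
     10 ::= .get 3 (𝐯 9))
    (10 ::= .get 2 (𝐯 11) ;;
     .put 2 (𝐯 11) (𝐥 0) ;;
     11 ::= 𝐯 11 +ₑ 𝐥 1)

/-- Array `k` starts with the list `L`. -/
def Holds (s : Env) (k : ℕ) (L : List ℕ) : Prop := ∀ (i : ℕ) (h : i < L.length), s.arr k i = L[i]

section sort

variable {D : Dims} {s : Env} {key : ℕ → ℕ} {d : ℕ} {L : List ℕ}

/-- Array `2` holds the heads of the buckets and array `3` the links. The list is read from its end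
and each position is pushed to the front of its bucket, so every bucket keeps the order of `L`; this
makes the sort stable. Variable `7` is the bitwise disjunction of what remains of the letters after
the current digit, and so tells whether another pass is needed. -/
theorem runs_scatter (hm : D.m = 8) (hW : 8 * D.len ≤ 2 ^ D.W) (hn : s.v 0 = D.len)
    (hT : ∀ p < D.len, s.arr 0 p = key p) (hd : s.v 6 = d) (hA : Holds s 1 L)
    (hL : L.Perm (List.range D.len)) (hH : ∀ i < D.len, s.arr 2 i = 0) (hi : s.v 8 = D.len)
    (h7 : s.v 7 = 0) :
    Runs D (.while (𝐯 8) scatterBody) s fun s' t =>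
      Frame scatterBody s s' ∧ t ≤ 40 * D.len + 2 ∧
      (∀ i < D.len, Chain (s'.arr 3) (s'.arr 2 i) (L.filter fun p => key p / d % D.len = i)) ∧
      (s'.v 7 ≠ 0 ↔ ∃ p < D.len, key p / d / D.len ≠ 0) := by
  have hlen : L.length = D.len := by simpa using hL.length_eq
  have hlt : ∀ p ∈ L, p < D.len := fun p hp => by simpa using hL.mem_iff.1 hp
  have hnd : L.Nodup := hL.nodup_iff.2 List.nodup_range
  refine Runs.while (fun k s' => s'.v 8 = k ∧ k ≤ D.len ∧
    (∀ i < D.len, Chain (s'.arr 3) (s'.arr 2 i)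
      ((L.drop k).filter fun p => key p / d % D.len = i)) ∧
    (s'.v 7 ≠ 0 ↔ ∃ p ∈ L.drop k, key p / d / D.len ≠ 0)) 38 D.len ?_ ?_ ?_ ?_
  · refine ⟨hi, le_rfl, fun i hi => ?_, ?_⟩
    · rw [List.drop_eq_nil_of_le hlen.le]
      exact hH i hi
    · simp [List.drop_eq_nil_of_le hlen.le, h7]
  · simp
  · rintro k s' hf ⟨h8, hk, hC, hF⟩ hne R hR
    simp only [Exp.eval, h8] at hne
    obtain ⟨k, rfl⟩ := Nat.exists_eq_succ_of_ne_zero hne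
    simp only [Nat.succ_eq_add_one] at *
    have hkl : k < L.length := by omega
    have h1 : s'.arr 1 k = L[k] := by rw [hf.arr 1 (by decide)]; exact hA k hkl
    have hp : L[k] < D.len := hlt _ (List.getElem_mem _)
    have h0 : s'.arr 0 L[k] = key L[k] := by rw [hf.arr 0 (by decide)]; exact hT _ hp
    have h6 : s'.v 6 = d := by rw [hf.v 6 (by decide), hd]
    have hv0 : s'.v 0 = D.len := by rw [hf.v 0 (by decide), hn]
    have hq : key L[k] / d % D.len < D.len := Nat.mod_lt _ (by omega)
    have hdrop : L.drop k = L[k] :: L.drop (k + 1) := List.drop_eq_getElem_cons hkl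
    have hnot : L[k] ∉ L.drop (k + 1) := by
      have := hnd.sublist (List.drop_sublist k L)
      rw [hdrop, List.nodup_cons] at this
      exact this.1
    simp only [scatterBody, runs_seq, runs_asg, runs_put]
    have hW0 := wordSize_ne_zero hW (by omega)
    simp [h8, h1, h0, h6, hv0, hm, hq, hp, hW0]
    refine ⟨by omega, by omega, by omega, hR k _ _ (by omega) (by omega)
      ⟨by simp, by omega, ?_, ?_⟩⟩
    · intro i hi
      simp
      have hCi := (hC i hi)
      -- Setting the link of `L[k]` does not disturb the existing chains, because `L` has no
      -- repetitions.
      have hcongr : ∀ p ∈ (L.drop (k + 1)).filter fun p => key p / d % D.len = i,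
          (if p = L[k] then s'.arr 2 (key L[k] / d % D.len) else s'.arr 3 p) = s'.arr 3 p := by
        intro p hp
        rw [if_neg]
        rintro rfl
        exact hnot (List.mem_filter.1 hp).1
      rw [hdrop, List.filter_cons]
      by_cases hik : i = key L[k] / d % D.len
      · rw [if_pos hik, if_pos (by simp [hik])]
        refine ⟨rfl, ?_⟩
        simp only [if_true]
        rw [← hik]
        rw [← hik] at hcongr
        exact hCi.congr hcongr
      · rw [if_neg hik, if_neg (by simpa using Ne.symm hik)]
        exact hCi.congr hcongr
    · change (s'.v 7 ||| key L[k] / d / D.len) ≠ 0 ↔ _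
      rw [hdrop, Ne, Nat.or_eq_zero_iff]
      simp only [List.mem_cons, exists_eq_or_imp]
      rw [← hF]
      tauto
  · rintro k s' t hf ⟨h8, hk, hC, hF⟩ hz ht
    simp only [Exp.eval, h8] at hz
    subst hz
    simp only [List.drop_zero] at hC hF
    refine ⟨hf, by simp at ht; omega, hC, hF.trans ⟨?_, ?_⟩⟩
    · rintro ⟨p, hp, h⟩; exact ⟨p, hlt p hp, h⟩
    · rintro ⟨p, hp, h⟩; exact ⟨p, hL.mem_iff.2 (by simpa using hp), h⟩

theorem runs_collect (hm : D.m = 8) (hW : 8 * D.len ≤ 2 ^ D.W) (hn : s.v 0 = D.len)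
    {bucket : ℕ → List ℕ} (hlen : ((List.range D.len).flatMap bucket).length = D.len)
    (hlt : ∀ p ∈ (List.range D.len).flatMap bucket, p < D.len)
    (hC : ∀ i < D.len, Chain (s.arr 3) (s.arr 2 i) (bucket i))
    (h10 : s.v 10 = 0) (h11 : s.v 11 = 0) (h12 : s.v 12 = 0) :
    Runs D (.while (𝐯 11 <ₑ 𝐯 0 |ₑ 𝐯 10) collectBody) s fun s' t =>
      Frame collectBody s s' ∧ t ≤ 60 * D.len + 10 ∧
      (∀ i < D.len, s'.arr 2 i = 0) ∧ Holds s' 1 ((List.range D.len).flatMap bucket) := by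
  -- Here `out` is the output so far and `l` the rest of the chain being copied. Each iteration
  -- either outputs one position or moves to the next bucket, so the sum of the remaining buckets
  -- and the remaining positions drops by one; it starts at `2 * D.len`.
  refine Runs.while (fun k s' => ∃ out l : List ℕ, k = (D.len - s'.v 11) + (D.len - s'.v 12) ∧
    s'.v 11 ≤ D.len ∧ s'.v 12 = out.length ∧ Holds s' 1 out ∧ Chain (s'.arr 3) (s'.v 10) l ∧
    (∀ i < s'.v 11, s'.arr 2 i = 0) ∧
    (∀ i < D.len, s'.v 11 ≤ i → Chain (s'.arr 3) (s'.arr 2 i) (bucket i)) ∧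
    out ++ l ++ (List.range' (s'.v 11) (D.len - s'.v 11)).flatMap bucket =
      (List.range D.len).flatMap bucket) 24 (D.len + D.len) ?_ ?_ ?_ ?_
  · refine ⟨[], [], by simp [h11, h12], by omega, h12, by simp [Holds], h10, by simp [h11],
      fun i hi _ => hC i hi, by simp [h11, List.range_eq_range']⟩
  · simp
  · rintro k s' hf ⟨out, l, hk, hd, ho, hO, hl, hz, hB, hcat⟩ hne R hR
    have hv0 : s'.v 0 = D.len := by rw [hf.v 0 (by decide), hn]
    simp only [Exp.eval, exactValue, ne_eq, Nat.or_eq_zero_iff, hv0] at hne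
    simp only [collectBody, runs_ite, runs_seq, runs_asg, runs_put]
    refine ⟨trivial, ?_, ?_⟩
    · intro h10
      simp only [Exp.eval] at h10
      cases l with
      | nil => exact absurd hl h10
      | cons p l =>
        have hp : p < D.len := hlt p (by rw [← hcat]; simp)
        have hol : out.length < D.len := by
          rw [← hlen, ← hcat]; simp
        have hW0 := wordSize_ne_zero hW (by omega)
        simp [hl.1, hm, ho, hp, hol, hW0]
        refine ⟨by omega, by omega, hR (D.len - s'.v 11 + (D.len - (out.length + 1))) _ _ (by omega)
          (by omega) ⟨out ++ [p], l, rfl, hd, by simp, ?_, hl.2, hz, hB, by simpa using hcat⟩⟩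
        intro i hi
        simp only [Env.set_arr, Env.write_arr, if_true]
        by_cases hio : i = out.length
        · simp [hio]
        · rw [if_neg hio, hO i (by simp at hi; omega),
            List.getElem_append_left (by simp at hi; omega)]
    · intro h10
      simp only [Exp.eval] at h10
      have hdl : s'.v 11 < D.len := by
        by_contra hcon
        simp [h10, hcon] at hne
      cases l with
      | cons p l => exact absurd h10 (by rw [hl.1]; simp)
      | nil =>
        have hW0 := wordSize_ne_zero hW (by omega)
        simp [hm, hdl, hW0]
        refine ⟨by omega, hR (D.len - (s'.v 11 + 1) + (D.len - s'.v 12)) _ _ (by omega)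
          (by omega) ⟨out, bucket (s'.v 11), rfl, hdl, ho, hO, ?_, ?_, ?_, ?_⟩⟩
        · exact hB _ hdl le_rfl
        · intro i hi
          simp at hi ⊢
          exact fun hne => hz i (by omega)
        · intro i hi hle
          simp at hle ⊢
          rw [if_neg (by omega)]
          exact hB i hi (by omega)
        · rw [← hcat]
          have : D.len - s'.v 11 = (D.len - (s'.v 11 + 1)) + 1 := by omega
          rw [this, List.range'_succ]
          simp
  · rintro k s' t hf ⟨out, l, hk, hd, ho, hO, hl, hz, hB, hcat⟩ hzero ht
    have hv0 : s'.v 0 = D.len := by rw [hf.v 0 (by decide), hn]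
    simp only [Exp.eval, exactValue, Nat.or_eq_zero_iff, hv0] at hzero
    have hdl : s'.v 11 = D.len := by
      by_contra hcon
      have : s'.v 11 < D.len := by omega
      simp [this] at hzero
    have hl0 : l = [] := by
      cases l with
      | nil => rfl
      | cons p l => exact absurd hzero.2 (by rw [hl.1]; simp)
    subst hl0
    rw [hdl] at hcat hz
    simp only [Nat.sub_self, List.range'_zero, List.flatMap_nil, List.append_nil] at hcat
    subst hcat
    exact ⟨hf, by simp at ht; omega, hz, hO⟩

/-- One pass of the radix sort. -/
def passBody : Cmd :=
  7 ::= 𝐥 0 ;; 8 ::= 𝐯 0 ;; .while (𝐯 8) scatterBody ;;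
  10 ::= 𝐥 0 ;; 11 ::= 𝐥 0 ;; 12 ::= 𝐥 0 ;; .while (𝐯 11 <ₑ 𝐯 0 |ₑ 𝐯 10) collectBody ;;
  .ite (𝐯 7) (6 ::= 𝐯 6 *ₑ 𝐯 0) .skip

/-- The place value is multiplied by `D.len` only if some letter has a nonzero higher digit. Then `d
* D.len` is at most that letter, which is a word, so the product does not overflow although nothing
is assumed about `D.len ^ c`. -/
theorem runs_pass (hm : D.m = 8) (hW : 8 * D.len ≤ 2 ^ D.W) (hpos : 0 < D.len) (hn : s.v 0 = D.len)
    (hT : ∀ p < D.len, s.arr 0 p = key p) (hkey : ∀ p < D.len, key p < 2 ^ D.W) (hd : s.v 6 = d)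
    (hA : Holds s 1 L) (hL : L.Perm (List.range D.len)) (hH : ∀ i < D.len, s.arr 2 i = 0) :
    Runs D passBody s fun s' t => t ≤ 100 * D.len + 100 ∧
      (∀ i < D.len, s'.arr 2 i = 0) ∧
      Holds s' 1 (bucketSort D.len (fun p => key p / d % D.len) L) ∧
      (s'.v 7 ≠ 0 ↔ ∃ p < D.len, key p / d / D.len ≠ 0) ∧ (s'.v 7 ≠ 0 → s'.v 6 = d * D.len) := by
  have hperm : (bucketSort D.len (fun p => key p / d % D.len) L).Perm (List.range D.len) :=
    (perm_bucketSort (hL.nodup_iff.2 List.nodup_range) fun p _ => Nat.mod_lt _ hpos).trans hL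
  simp only [passBody, runs_seq, runs_asg]
  refine ⟨by simp, trivial, ?_⟩
  refine (runs_scatter (key := key) (d := d) (L := L) hm hW (by simpa using hn) (by simpa using hT)
    (by simpa using hd) (by simpa [Holds] using hA) hL (by simpa using hH) (by simpa using hn)
    (by simp)).mono ?_
  rintro s₁ t₁ ⟨hf₁, ht₁, hC, hF⟩
  have hn₁ : s₁.v 0 = D.len := by rw [hf₁.v 0 (by decide)]; simpa using hn
  refine ⟨by simp, by simp, by simp, ?_⟩
  refine (runs_collect (bucket := fun i => L.filter fun p => key p / d % D.len = i) hm hW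
    (by simpa using hn₁) (by simpa [bucketSort] using hperm.length_eq)
    (fun p hp => by simpa using hperm.mem_iff.1 hp) (by simpa using hC)
    (by simp) (by simp) (by simp)).mono ?_
  rintro s₂ t₂ ⟨hf₂, ht₂, hH₂, hA₂⟩
  have h7 : s₂.v 7 = s₁.v 7 := by rw [hf₂.v 7 (by decide)]; simp
  have h6 : s₂.v 6 = d := by
    rw [hf₂.v 6 (by decide)]; simp; rw [hf₁.v 6 (by decide)]; simpa using hd
  have h0 : s₂.v 0 = D.len := by rw [hf₂.v 0 (by decide)]; simpa using hn₁
  rw [← h7] at hF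
  rw [runs_ite]
  refine ⟨trivial, fun hne => ?_, fun hz => ?_⟩
  · simp only [Exp.eval] at hne
    obtain ⟨p, hp, hp'⟩ := hF.1 hne
    have hle : d * D.len ≤ key p := by
      rw [Nat.div_div_eq_div_mul] at hp'
      by_contra hcon
      exact hp' (Nat.div_eq_of_lt (by omega))
    simp only [runs_asg]
    refine ⟨⟨trivial, trivial, ?_⟩, by simp; omega, by simpa using hH₂, ?_, by simpa using hF,
      by simp [h6, h0]⟩
    · simp only [Fits, Exp.eval, h6, h0]
      exact hle.trans_lt (hkey p hp)
    · exact hA₂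
  · simp only [Exp.eval] at hz
    simp only [runs_skip]
    exact ⟨by simp; omega, hH₂, hA₂, hF, fun h => absurd hz h⟩

/-- Sort the positions of the text in array `0` by their letters; the result is in array `1`. -/
def sortCmd : Cmd :=
  8 ::= 𝐥 0 ;; .while (𝐯 8 <ₑ 𝐯 0) (.put 1 (𝐯 8) (𝐯 8) ;; 8 ::= 𝐯 8 +ₑ 𝐥 1) ;;
  6 ::= 𝐥 1 ;; 7 ::= 𝐥 1 ;; .while (𝐯 7) passBody

/-- After `j` passes the positions are sorted by their letters modulo `D.len ^ j`, and the loop ends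
once all letters lie below `D.len ^ j`. A pass with `j > 0` starts only if some letter is at least
`D.len ^ j`, which forces `j < c`. The bound `c + 1` also covers the pass for `j = 0`, which always
takes place. Only the analysis involves `c`. -/
theorem runs_sort (hm : D.m = 8) (hW : 8 * D.len ≤ 2 ^ D.W) (hpos : 0 < D.len) (hn : s.v 0 = D.len)
    (hT : ∀ p < D.len, s.arr 0 p = key p) (hkey : ∀ p < D.len, key p < 2 ^ D.W) {c : ℕ}
    (hc : ∀ p < D.len, key p < D.len ^ c) (hH : ∀ i < D.len, s.arr 2 i = 0) :
    Runs D sortCmd s fun s' t => Frame sortCmd s s' ∧ t ≤ 300 * (c + 1) * D.len ∧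
      ∃ L : List ℕ, L.Perm (List.range D.len) ∧ Holds s' 1 L ∧
        L.Pairwise fun p q => key p ≤ key q := by
  have hW0 := wordSize_ne_zero hW hpos
  apply (Runs.frame (Q := fun s' t => _) _).mono
  · exact fun s' t h => h
  simp only [sortCmd, runs_seq, runs_asg]
  refine ⟨by simp, ?_⟩
  refine Runs.while (fun k s' => s'.v 8 ≤ D.len ∧ k = D.len - s'.v 8 ∧
    ∀ i < s'.v 8, s'.arr 1 i = i) 12 D.len ?_ ?_ ?_ ?_
  · simp
  · simp
  · rintro k s' hf ⟨h8, hk, hA⟩ hne R hR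
    have hv0 : s'.v 0 = D.len := by rw [hf.v 0 (by decide)]; simpa using hn
    simp [hv0] at hne
    simp [hm, hne, hW0]
    refine ⟨by omega, hR (D.len - (s'.v 8 + 1)) _ _ (by omega) (by omega) ⟨hne, rfl, ?_⟩⟩
    intro i hi
    simp at hi ⊢
    split_ifs with h
    · exact h.symm
    · exact hA i (by omega)
  · rintro k s' t hf ⟨h8, hk, hA⟩ hz ht
    have hv0 : s'.v 0 = D.len := by rw [hf.v 0 (by decide)]; simpa using hn
    simp [hv0] at hz ht
    have h8' : s'.v 8 = D.len := le_antisymm h8 hz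
    rw [h8'] at hA
    refine ⟨by simp [hW0], by simp [hW0], ?_⟩
    refine Runs.while (fun k s' => ∃ L j, L.Perm (List.range D.len) ∧ Holds s' 1 L ∧
      (∀ i < D.len, s'.arr 2 i = 0) ∧
      L.Pairwise (fun p q => key p % D.len ^ j ≤ key q % D.len ^ j) ∧
      (s'.v 7 ≠ 0 → s'.v 6 = D.len ^ j ∧ (j = 0 ∨ ∃ p < D.len, D.len ^ j ≤ key p)) ∧
      (s'.v 7 = 0 → ∀ p < D.len, key p < D.len ^ j) ∧ k = c + 1 - j)
      (100 * D.len + 100) (c + 1) ?_ ?_ ?_ ?_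
    · refine ⟨List.range D.len, 0, List.Perm.refl _, ?_, ?_, ?_, by simp, by simp, rfl⟩
      · intro i hi
        simpa using hA i (by simpa using hi)
      · intro i hi
        simp [hf.arr 2 (by decide), hH i hi]
      · simp [Nat.mod_one, List.pairwise_iff_getElem]
    · simp
    · rintro k s₂ hf₂ ⟨L, j, hL, hA₂, hH₂, hP, h7, -, rfl⟩ hne R hR
      obtain ⟨h6, hj⟩ := h7 hne
      have hjc : j < c + 1 := by
        rcases hj with rfl | ⟨p, hp, hle⟩
        · omega
        · by_contra hcon
          have := Nat.pow_le_pow_right hpos (show c ≤ j by omega)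
          have := hc p hp
          omega
      have hn₂ : s₂.v 0 = D.len := by rw [hf₂.v 0 (by decide)]; simpa using hv0
      have hT₂ : ∀ p < D.len, s₂.arr 0 p = key p := by
        intro p hp
        rw [hf₂.arr 0 (by decide)]
        simp [hf.arr 0 (by decide), hT p hp]
      refine (runs_pass (key := key) hm hW hpos hn₂ hT₂ hkey h6 hA₂ hL hH₂).mono ?_
      rintro s₃ t₃ ⟨ht₃, hH₃, hA₃, hF, h6₃⟩
      refine hR (c + 1 - (j + 1)) _ _ (by omega) ht₃ ⟨_, j + 1, ?_, hA₃, hH₃, ?_, ?_, ?_, rfl⟩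
      · exact (perm_bucketSort (hL.nodup_iff.2 List.nodup_range)
          fun p _ => Nat.mod_lt _ hpos).trans hL
      · simpa [pow_succ] using pairwise_bucketSort (n := D.len) hP
      · intro h
        refine ⟨by rw [h6₃ h, pow_succ], Or.inr ?_⟩
        obtain ⟨p, hp, hne⟩ := hF.1 h
        refine ⟨p, hp, ?_⟩
        rw [Nat.div_div_eq_div_mul, ← pow_succ] at hne
        by_contra hcon
        exact hne (Nat.div_eq_of_lt (by omega))
      · intro h p hp
        by_contra hcon
        refine hF.2 ⟨p, hp, ?_⟩ h
        rw [Nat.div_div_eq_div_mul, ← pow_succ]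
        exact (Nat.div_pos (by omega) (by positivity)).ne'
    · rintro k s₂ t₂ hf₂ ⟨L, j, hL, hA₂, hH₂, hP, -, h7, rfl⟩ hz ht₂
      refine ⟨?_, L, hL, hA₂, ?_⟩
      · simp at ht₂ ⊢
        nlinarith
      · have hlt : ∀ p ∈ L, p < D.len := fun p hp => by simpa using hL.mem_iff.1 hp
        refine hP.imp_of_mem fun {p q} hp hq h => ?_
        rwa [Nat.mod_eq_of_lt (h7 hz p (hlt p hp)), Nat.mod_eq_of_lt (h7 hz q (hlt q hq))] at h

end sort

/-! ### Ranks of letters within blocks -/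

theorem sum_mul_pow_lt {a : ℕ → ℕ} {B m : ℕ} (h : ∀ k < m, a k < B) :
    ∑ k ∈ Finset.range m, a k * B ^ k < B ^ m := by
  induction m with
  | zero => simp
  | succ m ih =>
    rw [Finset.sum_range_succ, pow_succ]
    have h1 := ih fun k hk => h k (by omega)
    have h2 : (a m + 1) * B ^ m ≤ B * B ^ m := Nat.mul_le_mul_right _ (h m (by omega))
    nlinarith

/-- The letters with numbers `val 0, …, val (2 * t - 1)` as one number with digits of `w` bits. -/
def blockId (t w : ℕ) (val : ℕ → ℕ) : ℕ := ∑ k ∈ Finset.range (2 * t), val k * (2 ^ w) ^ k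

/-- The word that stores the identifiers of the blocks `q * g, …, q * g + g - 1`. -/
def packed (t w g : ℕ) (val : ℕ → ℕ → ℕ) (q : ℕ) : ℕ :=
  ∑ r ∈ Finset.range g, blockId t w (val (q * g + r)) * (2 ^ (2 * t * w)) ^ r

theorem blockId_lt {t w : ℕ} {val : ℕ → ℕ} (h : ∀ k < 2 * t, val k < 2 ^ w) :
    blockId t w val < 2 ^ (2 * t * w) := by
  have := sum_mul_pow_lt h
  rwa [← pow_mul, mul_comm w] at this

theorem packed_lt {t w g : ℕ} {val : ℕ → ℕ → ℕ} (h : ∀ J, ∀ k < 2 * t, val J k < 2 ^ w) (q : ℕ) :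
    packed t w g val q < (2 ^ (2 * t * w)) ^ g :=
  sum_mul_pow_lt fun _ _ => blockId_lt (h _)

/-- Each digit is written once, over a `0`, so writing it amounts to an addition and nothing has to
be cleared. This is what the field `Ranked.zero` is for. -/
theorem blockId_update {t w k v : ℕ} {val : ℕ → ℕ} (hk : k < 2 * t) (h : val k = 0) :
    blockId t w (Function.update val k v) = blockId t w val + v * (2 ^ w) ^ k := by
  have : ∀ i, Function.update val k v i * (2 ^ w) ^ i =
      val i * (2 ^ w) ^ i + if i = k then v * (2 ^ w) ^ k else 0 := by
    intro i
    by_cases hi : i = k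
    · subst hi; simp [h]
    · simp [hi]
  simp only [blockId, this, Finset.sum_add_distrib]
  simp [hk]

theorem packed_update {t w g J δ : ℕ} {val : ℕ → ℕ → ℕ} {f : ℕ → ℕ} (hg : 1 ≤ g)
    (h : blockId t w f = blockId t w (val J) + δ) (q : ℕ) :
    packed t w g (Function.update val J f) q =
      packed t w g val q + if q = J / g then δ * (2 ^ (2 * t * w)) ^ (J % g) else 0 := by
  have hJ := Nat.div_add_mod J g
  have hlt := Nat.mod_lt J hg
  have : ∀ r ∈ Finset.range g,
      blockId t w (Function.update val J f (q * g + r)) * (2 ^ (2 * t * w)) ^ r =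
      blockId t w (val (q * g + r)) * (2 ^ (2 * t * w)) ^ r +
        if r = J % g then (if q = J / g then δ * (2 ^ (2 * t * w)) ^ (J % g) else 0) else 0 := by
    intro r hr
    rw [Finset.mem_range] at hr
    by_cases hi : q * g + r = J
    · have hq : q = J / g := by
        rw [← hi, add_comm, Nat.add_mul_div_right _ _ hg, Nat.div_eq_of_lt hr, zero_add]
      have hr' : r = J % g := by
        rw [← hi, add_comm, Nat.add_mul_mod_self_right, Nat.mod_eq_of_lt hr]
      rw [if_pos hr', if_pos hq, hi, Function.update_self, h, ← hr']
      ring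
    · rw [Function.update_of_ne hi]
      split_ifs with h1 h2
      · exfalso
        apply hi
        rw [h1, h2, mul_comm, hJ]
      · simp
      · simp
  rw [packed, Finset.sum_congr rfl this, Finset.sum_add_distrib]
  simp [packed, hlt]

/-- The numbers `val` given to the elements of `S` are ordered like their letters; `last` is the
greatest letter so far, and it has number `cnt`. -/
structure Ranked (ltr : ℕ → ℕ) (S : Finset ℕ) (val : ℕ → ℕ) (cnt last : ℕ) : Prop where
  le_last : ∀ k ∈ S, ltr k ≤ last
  eq_cnt : ∀ k ∈ S, ltr k = last → val k = cnt
  lt_cnt : ∀ k ∈ S, ltr k < last → val k < cnt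
  mono : ∀ k ∈ S, ∀ l ∈ S, ltr k < ltr l → val k < val l
  congr : ∀ k ∈ S, ∀ l ∈ S, ltr k = ltr l → val k = val l
  card : cnt ≤ S.card
  last : last = 0 ∨ ∃ k ∈ S, ltr k = last
  zero : ∀ k, k ∉ S → val k = 0

theorem Ranked.val_le {ltr val : ℕ → ℕ} {S : Finset ℕ} {cnt last : ℕ}
    (h : Ranked ltr S val cnt last) (k : ℕ) : val k ≤ cnt := by
  by_cases hk : k ∈ S
  · rcases (h.le_last k hk).lt_or_eq with h1 | h1
    · exact (h.lt_cnt k hk h1).le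
    · exact (h.eq_cnt k hk h1).le
  · simp [h.zero k hk]

/-- Letters arrive in nondecreasing order, so a new letter either equals the last one and shares its
number, or exceeds all earlier ones and gets a larger number. The initial values `cnt = last = 0`
need no special case: a first letter `0` gets the number `0`, any other first letter the number `1`.
-/
theorem Ranked.insert {ltr val : ℕ → ℕ} {S : Finset ℕ} {cnt last k : ℕ}
    (h : Ranked ltr S val cnt last) (hk : k ∉ S) (hx : ∀ l ∈ S, ltr l ≤ ltr k) {cnt' : ℕ}
    (hc : cnt' = if last = ltr k then cnt else cnt + 1) :
    Ranked ltr (insert k S) (Function.update val k cnt') cnt' (ltr k) := by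
  have hlast : last ≤ ltr k := by
    rcases h.last with h1 | ⟨l, hl, h1⟩
    · omega
    · rw [← h1]; exact hx l hl
  have hne : ∀ l ∈ S, Function.update val k cnt' l = val l := fun l hl =>
    Function.update_of_ne (by rintro rfl; exact hk hl) _ _
  have hlt : ∀ l ∈ S, ltr l < ltr k → val l < cnt' := by
    intro l hl hlk
    split_ifs at hc with h1
    · rw [hc]; exact h.lt_cnt l hl (by omega)
    · have := h.val_le l; omega
  have heq : ∀ l ∈ S, ltr l = ltr k → val l = cnt' := by
    intro l hl hlk
    split_ifs at hc with h1
    · rw [hc]; exact h.eq_cnt l hl (by omega)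
    · have := h.le_last l hl; omega
  constructor
  · simpa using hx
  · simp only [Finset.mem_insert, forall_eq_or_imp, Function.update_self, implies_true, true_and]
    exact fun l hl hlk => by rw [hne l hl, heq l hl hlk]
  · simp only [Finset.mem_insert, forall_eq_or_imp, lt_irrefl, false_imp_iff, true_and]
    exact fun l hl hlk => by rw [hne l hl]; exact hlt l hl hlk
  · simp only [Finset.mem_insert, forall_eq_or_imp, lt_irrefl, false_imp_iff, true_and,
      Function.update_self]
    refine ⟨fun l hl hkl => ?_, fun l hl => ⟨fun hlk => ?_, fun m hm hlm => ?_⟩⟩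
    · have := hx l hl; omega
    · rw [hne l hl]; exact hlt l hl hlk
    · rw [hne l hl, hne m hm]; exact h.mono l hl m hm hlm
  · simp only [Finset.mem_insert, forall_eq_or_imp, true_and, Function.update_self, implies_true]
    refine ⟨fun l hl hkl => ?_, fun l hl => ⟨fun hlk => ?_, fun m hm hlm => ?_⟩⟩
    · rw [hne l hl, heq l hl hkl.symm]
    · rw [hne l hl, heq l hl hlk]
    · rw [hne l hl, hne m hm]; exact h.congr l hl m hm hlm
  · rw [Finset.card_insert_of_notMem hk]
    have := h.card
    split_ifs at hc <;> omega
  · exact Or.inr ⟨k, by simp, rfl⟩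
  · intro l hl
    simp only [Finset.mem_insert, not_or] at hl
    rw [Function.update_of_ne hl.1, h.zero l hl.2]

/-! ### Parameters, and the sweep that numbers the letters of all blocks -/

/-- The parameters of the data structure: block length `t`, bits per letter `w`, blocks per
word `g`. -/
structure Params (n t w g : ℕ) : Prop where
  two_le : 2 ≤ t
  pow : 2 ^ w = 4 * t
  pow_four_le : (2 ^ (2 * t * w)) ^ 4 ≤ n
  g_pos : 1 ≤ g
  le : (2 ^ (2 * t * w)) ^ g ≤ n
  lt : n < (2 ^ (2 * t * w)) ^ (g + 1)

theorem Params.three_le {n t w g : ℕ} (h : Params n t w g) : 3 ≤ w := by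
  by_contra hcon
  have h1 := h.pow
  have h2 := h.two_le
  have : 2 ^ w ≤ 2 ^ 2 := Nat.pow_le_pow_right (by omega) (by omega)
  omega

theorem Params.shift_lt {n t w g : ℕ} (h : Params n t w g) : 2 * t * w * g < n := by
  have h1 := h.le
  rw [← pow_mul] at h1
  exact Nat.lt_two_pow_self.trans_le h1

theorem Params.bits_lt {n t w g : ℕ} (h : Params n t w g) : 8 * t * w < n := by
  have h1 := h.pow_four_le
  rw [← pow_mul] at h1
  have : 2 * t * w * 4 < n := Nat.lt_two_pow_self.trans_le h1
  linarith

theorem Params.t_lt {n t w g : ℕ} (h : Params n t w g) : 24 * t < n := by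
  have h1 := h.bits_lt
  have h2 := h.three_le
  nlinarith

/-- The state of the sweep: `S J` is the set of letters of block `J` that have got their numbers. -/
structure Swept (key : ℕ → ℕ) (t w g : ℕ) (s : Env) (S : ℕ → Finset ℕ) (val : ℕ → ℕ → ℕ) :
    Prop where
  ranked : ∀ J, Ranked (fun k => key (J * t + k - t)) (S J) (val J) (s.arr 4 J) (s.arr 5 J)
  packed : ∀ q, s.arr 6 q = packed t w g val q
  subset : ∀ J, S J ⊆ Finset.range (2 * t)

/-- Give a number to the letter `v10` at offset `v16` of block `v15`. -/
def rankCmd : Cmd :=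
  .ite (.get 5 (𝐯 15) =ₑ 𝐯 10) .skip
    (.put 4 (𝐯 15) (.get 4 (𝐯 15) +ₑ 𝐥 1) ;; .put 5 (𝐯 15) (𝐯 10)) ;;
  17 ::= 𝐯 15 /ₑ 𝐯 5 ;;
  18 ::= 𝐯 3 *ₑ ((𝐯 2 +ₑ 𝐯 2) *ₑ (𝐯 15 %ₑ 𝐯 5) +ₑ 𝐯 16) ;;
  .put 6 (𝐯 17) (.get 6 (𝐯 17) +ₑ .get 4 (𝐯 15) <<ₑ 𝐯 18)

/-- A counter never exceeds the number of letters counted, hence is at most `2 * t`. The value `2 *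
t` does occur when all letters are distinct and nonzero, so `2 ^ w` has to exceed `2 * t`; it is `4
* t`. -/
theorem Swept.val_lt {key : ℕ → ℕ} {n t w g : ℕ} {s : Env} {S : ℕ → Finset ℕ} {val : ℕ → ℕ → ℕ}
    (h : Swept key t w g s S val) (hP : Params n t w g) (J k : ℕ) : val J k < 2 ^ w := by
  have h1 := (h.ranked J).val_le k
  have h2 := (h.ranked J).card
  have h3 := Finset.card_le_card (h.subset J)
  have h4 := hP.two_le
  rw [Finset.card_range] at h3
  rw [hP.pow]
  omega

/-- The effect of `rankCmd` on the invariant, as far as the arrays are concerned. -/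
theorem Swept.insert {key : ℕ → ℕ} {n t w g : ℕ} {s s' : Env} {S : ℕ → Finset ℕ}
    {val : ℕ → ℕ → ℕ} (h : Swept key t w g s S val) (hP : Params n t w g) {J k c : ℕ}
    (hk : k < 2 * t) (hkS : k ∉ S J) (hx : ∀ l ∈ S J, key (J * t + l - t) ≤ key (J * t + k - t))
    (hc : c = if s.arr 5 J = key (J * t + k - t) then s.arr 4 J else s.arr 4 J + 1)
    (h4 : ∀ i, s'.arr 4 i = if i = J then c else s.arr 4 i)
    (h5 : ∀ i, s'.arr 5 i = if i = J then key (J * t + k - t) else s.arr 5 i)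
    (h6 : ∀ q, s'.arr 6 q = s.arr 6 q +
      if q = J / g then c * 2 ^ (w * (2 * t * (J % g) + k)) else 0) :
    Swept key t w g s' (Function.update S J (insert k (S J)))
      (Function.update val J (Function.update (val J) k c)) where
  ranked i := by
    by_cases hi : i = J
    · subst hi
      have := (h.ranked i).insert hkS hx hc
      simpa [h4, h5] using this
    · simpa [h4, h5, hi] using h.ranked i
  packed q := by
    rw [packed_update hP.g_pos (blockId_update hk ((h.ranked J).zero k hkS)), h6, h.packed]
    congr 2
    rw [← pow_mul, ← pow_mul, mul_assoc c, ← pow_add]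
    congr 2
    ring
  subset i := by
    by_cases hi : i = J
    · subst hi
      simpa [Finset.insert_subset_iff, hk] using h.subset i
    · simpa [hi] using h.subset i

theorem runs_rank {D : Dims} {key : ℕ → ℕ} {t w g : ℕ} {s : Env} {S : ℕ → Finset ℕ}
    {val : ℕ → ℕ → ℕ} (hm : D.m = 8) (hW : 8 * D.len ≤ 2 ^ D.W) (hP : Params D.len t w g)
    (h : Swept key t w g s S val) (h2 : s.v 2 = t) (h3 : s.v 3 = w) (h5 : s.v 5 = g) {J k : ℕ}
    (hk : k < 2 * t) (hkS : k ∉ S J) (hx : ∀ l ∈ S J, key (J * t + l - t) ≤ key (J * t + k - t))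
    (hJ : J < D.len) (h10 : s.v 10 = key (J * t + k - t)) (h15 : s.v 15 = J) (h16 : s.v 16 = k) :
    Runs D rankCmd s fun s' T => Frame rankCmd s s' ∧ T ≤ 60 ∧
      ∃ val', Swept key t w g s' (Function.update S J (insert k (S J))) val' := by
  have hlen : 0 < D.len := by omega
  have hW0 := wordSize_ne_zero hW hlen
  have htn := hP.t_lt
  have hgn := hP.shift_lt
  have hbn := hP.bits_lt
  have hw3 := hP.three_le
  have hcard : s.arr 4 J ≤ 2 * t := by
    have h2 := (h.ranked J).card
    have h3 := Finset.card_le_card (h.subset J)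
    rw [Finset.card_range] at h3
    omega
  have hqn : J / g < D.len := (Nat.div_le_self _ _).trans_lt hJ
  have hr : J % g + 1 ≤ g := Nat.mod_lt _ hP.g_pos
  have hmul : 2 * t * (J % g + 1) ≤ 2 * t * g := Nat.mul_le_mul_left _ hr
  rw [mul_add, mul_one] at hmul
  have hsh : w * (2 * t * (J % g) + k) < D.len := by
    refine lt_of_le_of_lt ?_ hgn
    calc w * (2 * t * (J % g) + k) ≤ w * (2 * t * g) := Nat.mul_le_mul_left _ (by omega)
      _ = 2 * t * w * g := by ring
  have hsh' : 2 * t * (J % g) + k < D.len := by nlinarith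
  set c := if s.arr 5 J = key (J * t + k - t) then s.arr 4 J else s.arr 4 J + 1 with hc
  -- An environment with the intended final arrays is written down before the command is run. The
  -- invariant holds for it, so the new word is again of the form `packed`, thus below `M ^ g ≤ n`.
  -- This shows in advance that neither the shift nor the addition overflows.
  obtain ⟨s', hs'⟩ : ∃ s' : Env,
    (∀ i, s'.arr 4 i = if i = J then c else s.arr 4 i) ∧
    (∀ i, s'.arr 5 i = if i = J then key (J * t + k - t) else s.arr 5 i) ∧
    (∀ q, s'.arr 6 q = s.arr 6 q +
      if q = J / g then c * 2 ^ (w * (2 * t * (J % g) + k)) else 0) := by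
    refine ⟨⟨s.v, fun a i => if a = 4 then (if i = J then c else s.arr 4 i) else if a = 5 then
      (if i = J then key (J * t + k - t) else s.arr 5 i) else s.arr 6 i +
      if i = J / g then c * 2 ^ (w * (2 * t * (J % g) + k)) else 0⟩, ?_, ?_, ?_⟩ <;> simp
  have hS' := h.insert hP hk hkS hx hc hs'.1 hs'.2.1 hs'.2.2
  have hbound : s.arr 6 (J / g) + c * 2 ^ (w * (2 * t * (J % g) + k)) < 2 ^ D.W := by
    have h6 := hs'.2.2 (J / g)
    rw [if_pos rfl, hS'.packed] at h6
    rw [← h6]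
    have h8 := packed_lt (t := t) (g := g) (fun J k _ => hS'.val_lt hP J k) (J / g)
    have h9 := hP.le
    omega
  have hcbound : c * 2 ^ (w * (2 * t * (J % g) + k)) < 2 ^ D.W := by omega
  apply Runs.mono (Q := fun s' T => Frame rankCmd s s' ∧ T ≤ 60 ∧
    (∀ i, s'.arr 4 i = if i = J then c else s.arr 4 i) ∧
    (∀ i, s'.arr 5 i = if i = J then key (J * t + k - t) else s.arr 5 i) ∧
    (∀ q, s'.arr 6 q = s.arr 6 q +
      if q = J / g then c * 2 ^ (w * (2 * t * (J % g) + k)) else 0))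
  swap
  · rintro s'' T ⟨hf, hT, h4, h5, h6⟩
    exact ⟨hf, hT, _, h.insert hP hk hkS hx hc h4 h5 h6⟩
  apply Runs.frame
  clear hs' hS'
  clear s'
  have htt : t + t = 2 * t := by ring
  by_cases hl : s.arr 5 J = key (J * t + k - t)
  · have hc' : c = s.arr 4 J := by rw [hc, if_pos hl]
    rw [hc'] at hbound hcbound ⊢
    simp [rankCmd, h10, h15, h16, h2, h3, h5, hm, hl, hJ, hW0, hqn, htt]
    refine ⟨⟨⟨⟨by omega, by omega⟩, by omega⟩, by omega⟩, ⟨hcbound, hbound⟩, ?_⟩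
    · intro i; split_ifs with hi <;> simp [hi]
  · have hc' : c = s.arr 4 J + 1 := by rw [hc, if_neg hl]
    rw [hc'] at hbound hcbound ⊢
    simp [rankCmd, h10, h15, h16, h2, h3, h5, hm, hl, hJ, hW0, hqn, htt]
    refine ⟨by omega, ⟨⟨⟨by omega, by omega⟩, by omega⟩, by omega⟩, ⟨hcbound, hbound⟩, ?_⟩
    · intro i; split_ifs with hi <;> simp [hi]

/-- Number the letters of all blocks, in the order given by array `1`. -/
def sweepBody : Cmd :=
  9 ::= .get 1 (𝐯 8) ;; 10 ::= .get 0 (𝐯 9) ;;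
  15 ::= 𝐯 9 /ₑ 𝐯 2 ;; 16 ::= 𝐯 9 %ₑ 𝐯 2 +ₑ 𝐯 2 ;; rankCmd ;;
  15 ::= 𝐯 15 +ₑ 𝐥 1 ;; 16 ::= 𝐯 16 -ₑ 𝐯 2 ;; rankCmd ;;
  8 ::= 𝐯 8 +ₑ 𝐥 1

/-- Number the letters of all blocks, in the order given by array `1`. -/
def sweepCmd : Cmd := 8 ::= 𝐥 0 ;; .while (𝐯 8 <ₑ 𝐯 0) sweepBody

theorem Swept.congr {key : ℕ → ℕ} {t w g : ℕ} {s s' : Env} {S : ℕ → Finset ℕ} {val : ℕ → ℕ → ℕ}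
    (h : Swept key t w g s S val) (h' : s'.arr = s.arr) : Swept key t w g s' S val :=
  ⟨by rw [h']; exact h.ranked, by rw [h']; exact h.packed, h.subset⟩

/-- Block `J` starts at position `J * t - t`, so position `p` has offset `p % t + t` in block `p /
t` and offset `p % t` in block `p / t + 1`. The invariant ties `S` to the processed prefix of the
sorted list in both directions: every member of `S` comes from a processed position, so an offset
being added is new and all earlier letters are at most the current one; and every processed position
is in both of its blocks. -/
theorem runs_sweep {D : Dims} {key : ℕ → ℕ} {t w g : ℕ} {s : Env} {L : List ℕ}
    (hm : D.m = 8) (hW : 8 * D.len ≤ 2 ^ D.W) (hP : Params D.len t w g)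
    (hn : s.v 0 = D.len) (h2 : s.v 2 = t) (h3 : s.v 3 = w) (h5 : s.v 5 = g)
    (hT : ∀ p < D.len, s.arr 0 p = key p) (hL : L.Perm (List.range D.len)) (hA : Holds s 1 L)
    (hsort : L.Pairwise fun p q => key p ≤ key q)
    (h4 : s.arr 4 = 0) (h5' : s.arr 5 = 0) (h6 : s.arr 6 = 0) :
    Runs D sweepCmd s fun s' T => Frame sweepCmd s s' ∧ T ≤ 300 * D.len ∧
      ∃ S val, Swept key t w g s' S val ∧
        ∀ J, ∀ k < 2 * t, t ≤ J * t + k → J * t + k - t < D.len → k ∈ S J := by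
  have htn := hP.t_lt
  have ht2 := hP.two_le
  have hlen : 0 < D.len := by omega
  have hW0 := wordSize_ne_zero hW hlen
  have hLlen : L.length = D.len := by simpa using hL.length_eq
  have hlt : ∀ p ∈ L, p < D.len := fun p hp => by simpa using hL.mem_iff.1 hp
  have hnd : L.Nodup := hL.nodup_iff.2 List.nodup_range
  apply Runs.frame
  simp only [sweepCmd, runs_seq, runs_asg]
  refine ⟨by simp, ?_⟩
  refine Runs.while (fun m s' => s'.v 8 ≤ D.len ∧ m = D.len - s'.v 8 ∧ ∃ S val,
    Swept key t w g s' S val ∧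
    (∀ J, ∀ k ∈ S J, ∃ p ∈ L.take (s'.v 8), p + t = J * t + k) ∧
    (∀ p ∈ L.take (s'.v 8), p % t + t ∈ S (p / t) ∧ p % t ∈ S (p / t + 1))) 200 D.len ?_ ?_ ?_ ?_
  · refine ⟨by simp, by simp, fun _ => ∅, fun _ _ => 0, ⟨?_, ?_, ?_⟩, by simp, by simp⟩
    · intro J
      simp only [Env.set_arr, h4, h5']
      constructor <;> simp
    · intro q
      simp [h6, packed, blockId]
    · simp
  · intro k s' hf hI
    simp
  · rintro m s₁ hf ⟨h8, hm', S, val, hS, hS1, hS2⟩ hne R hR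
    have hv0 : s₁.v 0 = D.len := by rw [hf.v 0 (by decide)]; simpa using hn
    have hv2 : s₁.v 2 = t := by rw [hf.v 2 (by decide)]; simpa using h2
    have hv3 : s₁.v 3 = w := by rw [hf.v 3 (by decide)]; simpa using h3
    have hv5 : s₁.v 5 = g := by rw [hf.v 5 (by decide)]; simpa using h5
    simp [hv0] at hne
    set i := s₁.v 8 with hi
    have hiL : i < L.length := by omega
    obtain ⟨p, hp⟩ : ∃ p, p = L[i] := ⟨_, rfl⟩
    have hpn : p < D.len := by rw [hp]; exact hlt _ (List.getElem_mem _)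
    have hA1 : s₁.arr 1 i = p := by rw [hf.arr 1 (by decide), hp]; exact hA i hiL
    have hT1 : s₁.arr 0 p = key p := by rw [hf.arr 0 (by decide)]; exact hT p hpn
    have htake : L.take (i + 1) = L.take i ++ [p] := by rw [hp, List.take_concat_get' L i hiL]
    have hnot : p ∉ L.take i := by
      have h1 : (L.take (i + 1)).Nodup := hnd.sublist (List.take_sublist _ _)
      rw [htake, List.nodup_append] at h1
      intro hmem
      exact h1.2.2 p hmem p (by simp) rfl
    have hle : ∀ p' ∈ L.take i, key p' ≤ key p := by
      have h1 := hsort.sublist (List.take_sublist (i + 1) L)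
      rw [htake, List.pairwise_append] at h1
      intro p' hp'
      exact h1.2.2 p' hp' p (by simp)
    have hdm := Nat.div_add_mod p t
    have hml := Nat.mod_lt p (show t > 0 by omega)
    have hcomm : t * (p / t) = p / t * t := mul_comm _ _
    -- Keeps the block `p / t + 1` within the bounds of the arrays.
    have hdl : p / t ≤ D.len / 2 :=
      (Nat.div_le_div_right hpn.le).trans (Nat.div_le_div_left ht2 (by omega))
    have hpos1 : p / t * t + (p % t + t) - t = p := by omega
    have hpos2 : (p / t + 1) * t + p % t - t = p := by rw [add_mul, one_mul]; omega
    simp only [sweepBody, runs_seq, runs_asg]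
    simp only [Exp.eval, Exp.Safe, exactValue, Fits, Env.set_v, Env.set_arr, hA1, hv2, hm, ← hi,
      Exp.cost]
    simp only [Nat.reduceEqDiff, if_false, if_true, hT1]
    refine ⟨⟨trivial, by omega, by omega⟩, ⟨trivial, by omega, hpn⟩, by simp, ⟨by simp, trivial,
      by omega⟩, ?_⟩
    refine (runs_rank (J := p / t) (k := p % t + t) (S := S) (val := val) hm hW hP
      (hS.congr (by simp)) (by simpa using hv2) (by simpa using hv3) (by simpa using hv5)
      (by omega) ?_ ?_ (by omega) (by simp [hpos1]) (by simp) (by simp)).mono ?_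
    · intro hmem
      obtain ⟨p', hp', he⟩ := hS1 _ _ hmem
      exact hnot (by rwa [show p = p' by omega])
    · intro l hl
      obtain ⟨p', hp', he⟩ := hS1 _ _ hl
      rw [hpos1, ← he, Nat.add_sub_cancel]
      exact hle p' hp'
    rintro s₂ T₂ ⟨hf₂, hT₂, val₂, hS₂⟩
    have hv2' : s₂.v 2 = t := by rw [hf₂.v 2 (by decide)]; simpa using hv2
    have hv15' : s₂.v 15 = p / t := by rw [hf₂.v 15 (by decide)]; simp
    have hv16' : s₂.v 16 = p % t + t := by rw [hf₂.v 16 (by decide)]; simp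
    simp only [hv2', hv15', hv16']
    have hne12 : p / t + 1 ≠ p / t := by omega
    refine ⟨⟨trivial, by omega, by omega⟩, ⟨trivial, trivial, by omega, by omega⟩, ?_⟩
    refine (runs_rank (J := p / t + 1) (k := p % t) hm hW hP
      (hS₂.congr (by simp)) (by simpa using hv2')
      (by rw [Env.set_v, Env.set_v, hf₂.v 3 (by decide)]; simpa using hv3)
      (by rw [Env.set_v, Env.set_v, hf₂.v 5 (by decide)]; simpa using hv5)
      (by omega) ?_ ?_ (by omega)
      (by rw [Env.set_v, Env.set_v, hf₂.v 10 (by decide)]; simp [hpos2]) (by simp)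
      (by simp)).mono ?_
    · rw [Function.update_of_ne hne12]
      intro hmem
      obtain ⟨p', hp', he⟩ := hS1 _ _ hmem
      exact hnot (by rwa [show p = p' by omega])
    · rw [Function.update_of_ne hne12]
      intro l hl
      obtain ⟨p', hp', he⟩ := hS1 _ _ hl
      rw [hpos2, ← he, Nat.add_sub_cancel]
      exact hle p' hp'
    rintro s₃ T₃ ⟨hf₃, hT₃, val₃, hS₃⟩
    have hv8' : s₃.v 8 = i := by
      rw [hf₃.v 8 (by decide), Env.set_v, Env.set_v, hf₂.v 8 (by decide)]; simp [hi]
    simp only [hv8']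
    refine ⟨⟨trivial, by omega, by omega⟩, hR (D.len - (i + 1)) _ _ (by omega) (by omega)
      ⟨by simp; omega, by simp, _, val₃, hS₃.congr (by simp), ?_, ?_⟩⟩
    · simp only [Env.set_v, if_true, htake]
      intro J k hk
      by_cases hJ2 : J = p / t + 1
      · subst hJ2
        rw [Function.update_self, Function.update_of_ne hne12, Finset.mem_insert] at hk
        rcases hk with rfl | hk
        · exact ⟨p, by simp, by rw [add_mul, one_mul]; omega⟩
        · obtain ⟨p', hp', he⟩ := hS1 _ _ hk
          exact ⟨p', by simp [hp'], he⟩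
      · rw [Function.update_of_ne hJ2] at hk
        by_cases hJ1 : J = p / t
        · subst hJ1
          rw [Function.update_self, Finset.mem_insert] at hk
          rcases hk with rfl | hk
          · exact ⟨p, by simp, by omega⟩
          · obtain ⟨p', hp', he⟩ := hS1 _ _ hk
            exact ⟨p', by simp [hp'], he⟩
        · rw [Function.update_of_ne hJ1] at hk
          obtain ⟨p', hp', he⟩ := hS1 _ _ hk
          exact ⟨p', by simp [hp'], he⟩
    · simp only [Env.set_v, if_true, htake]
      have hsub : ∀ J, S J ⊆ Function.update (Function.update S (p / t)
          (insert (p % t + t) (S (p / t)))) (p / t + 1) (insert (p % t)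
          (Function.update S (p / t) (insert (p % t + t) (S (p / t))) (p / t + 1))) J := by
        intro J k hk
        by_cases hJ2 : J = p / t + 1
        · subst hJ2
          rw [Function.update_self, Function.update_of_ne hne12]
          exact Finset.mem_insert_of_mem hk
        · rw [Function.update_of_ne hJ2]
          by_cases hJ1 : J = p / t
          · subst hJ1
            rw [Function.update_self]
            exact Finset.mem_insert_of_mem hk
          · rwa [Function.update_of_ne hJ1]
      intro p' hp'
      rw [List.mem_append, List.mem_singleton] at hp'
      rcases hp' with hp' | rfl
      · exact ⟨hsub _ (hS2 p' hp').1, hsub _ (hS2 p' hp').2⟩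
      · rw [Function.update_of_ne hne12.symm, Function.update_self, Function.update_self]
        exact ⟨Finset.mem_insert_self _ _, Finset.mem_insert_self _ _⟩
  · rintro m s₁ T hf ⟨h8, hm', S, val, hS, hS1, hS2⟩ hz hT'
    have hv0 : s₁.v 0 = D.len := by rw [hf.v 0 (by decide)]; simpa using hn
    simp [hv0] at hz hT'
    have h8' : s₁.v 8 = D.len := le_antisymm h8 hz
    refine ⟨by simp; omega, S, val, hS, ?_⟩
    intro J k hk hle hlt'
    rw [h8', ← hLlen, List.take_length] at hS2
    obtain ⟨h1, h2⟩ := hS2 (J * t + k - t) (hL.mem_iff.2 (by simpa using hlt'))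
    by_cases hkt : k < t
    · obtain ⟨J', rfl⟩ : ∃ J', J = J' + 1 := ⟨J - 1, by
        have : J ≠ 0 := by rintro rfl; omega
        omega⟩
      rw [show (J' + 1) * t + k - t = k + J' * t by rw [add_mul, one_mul]; omega,
        Nat.add_mul_div_right _ _ (by omega), Nat.add_mul_mod_self_right, Nat.div_eq_of_lt hkt,
        Nat.mod_eq_of_lt hkt, zero_add] at h2
      exact h2
    · rw [show J * t + k - t = (k - t) + J * t by omega,
        Nat.add_mul_div_right _ _ (by omega), Nat.add_mul_mod_self_right,
        Nat.div_eq_of_lt (by omega), Nat.mod_eq_of_lt (by omega), zero_add,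
        Nat.sub_add_cancel (by omega)] at h1
      exact h1

end ArrayLang

/-! ### Minimal suffixes by pairwise comparison -/

/-- The letters `f a, …, f (e - 1)`. -/
def suf (f : ℕ → ℕ) (a e : ℕ) : List ℕ := (List.range' a (e - a)).map f

theorem suf_self (f : ℕ → ℕ) (e : ℕ) : suf f e e = [] := by simp [suf]

theorem suf_of_lt (f : ℕ → ℕ) {a e : ℕ} (h : a < e) : suf f a e = f a :: suf f (a + 1) e := by
  rw [suf, show e - a = e - (a + 1) + 1 by omega, List.range'_succ]
  rfl

theorem suf_lt_iff_of_agree {f : ℕ → ℕ} {a b e m : ℕ} (ha : a + m ≤ e) (hb : b + m ≤ e)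
    (h : ∀ i < m, f (a + i) = f (b + i)) :
    suf f a e < suf f b e ↔ suf f (a + m) e < suf f (b + m) e := by
  induction m with
  | zero => rfl
  | succ m ih =>
    rw [ih (by omega) (by omega) fun i hi => h i (by omega), suf_of_lt f (show a + m < e by omega),
      suf_of_lt f (show b + m < e by omega), h m (by omega), List.cons_lt_cons_self]
    rfl

/-- The suffix at `a` is the shorter one. If the common prefix exhausts it, it is a proper prefix of
the other and therefore smaller; otherwise the first mismatch decides. -/
theorem suf_lt_iff {f : ℕ → ℕ} {a b e m : ℕ} (hba : b < a) (ha : a + m ≤ e)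
    (h : ∀ i < m, f (a + i) = f (b + i)) (hm : a + m = e ∨ f (a + m) ≠ f (b + m)) :
    suf f a e < suf f b e ↔ a + m = e ∨ f (a + m) < f (b + m) := by
  rw [suf_lt_iff_of_agree ha (by omega) h]
  rcases ha.lt_or_eq with hlt | heq
  · rw [suf_of_lt f hlt, suf_of_lt f (show b + m < e by omega), List.cons_lt_cons_iff]
    have h1 : f (a + m) ≠ f (b + m) := hm.resolve_left hlt.ne
    simp [h1, hlt.ne]
  · rw [heq, suf_self, suf_of_lt f (show b + m < e by omega)]
    simp

theorem suf_ne {f : ℕ → ℕ} {a b e : ℕ} (ha : a ≤ e) (hb : b ≤ e) (hab : a ≠ b) :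
    suf f a e ≠ suf f b e := by
  intro h
  have := congrArg List.length h
  simp [suf] at this
  omega

/-- Comparisons of suffixes depend only on the relative order of the letters. -/
theorem suf_lt_suf_iff_of_orderIso {f f' : ℕ → ℕ} {i e : ℕ}
    (h : ∀ x y, i ≤ x → x < e → i ≤ y → y < e → (f x < f y ↔ f' x < f' y)) :
    ∀ {a b : ℕ}, i ≤ a → i ≤ b → (suf f a e < suf f b e ↔ suf f' a e < suf f' b e) := by
  suffices H : ∀ d a b, e - a ≤ d → i ≤ a → i ≤ b →
      (suf f a e < suf f b e ↔ suf f' a e < suf f' b e) from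
    fun {a b} ha hb => H _ a b le_rfl ha hb
  intro d
  induction d with
  | zero =>
    intro a b hd ha hb
    have h1 : ∀ f : ℕ → ℕ, suf f a e = [] := fun f => by simp [suf]; omega
    rw [h1, h1]
    by_cases hbe : b < e
    · rw [suf_of_lt _ hbe, suf_of_lt _ hbe]; simp
    · have h2 : ∀ f : ℕ → ℕ, suf f b e = [] := fun f => by simp [suf]; omega
      rw [h2, h2]
  | succ d ih =>
    intro a b hd ha hb
    by_cases hbe : b < e
    · by_cases hae : a < e
      · rw [suf_of_lt _ hae, suf_of_lt _ hbe, suf_of_lt _ hae, suf_of_lt _ hbe,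
          List.cons_lt_cons_iff, List.cons_lt_cons_iff,
          ih (a + 1) (b + 1) (by omega) (by omega) (by omega)]
        have h1 := h a b ha hae hb hbe
        have h2 := h b a hb hbe ha hae
        have h3 : f a = f b ↔ f' a = f' b := by omega
        rw [h1, h3]
      · have h1 : ∀ f : ℕ → ℕ, suf f a e = [] := fun f => by simp [suf]; omega
        rw [h1, h1, suf_of_lt _ hbe, suf_of_lt _ hbe]; simp
    · have h2 : ∀ f : ℕ → ℕ, suf f b e = [] := fun f => by simp [suf]; omega
      rw [h2, h2]
      simp

/-- The suffix that starts at `b` is the least non-empty suffix of `f i, …, f (e - 1)`. -/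
def IsBest (f : ℕ → ℕ) (i e b : ℕ) : Prop :=
  i ≤ b ∧ b < e ∧ ∀ k, i ≤ k → k < e → k ≠ b → suf f b e < suf f k e

theorem IsBest.of_orderIso {f f' : ℕ → ℕ} {i e b : ℕ} (hb : IsBest f i e b)
    (h : ∀ x y, i ≤ x → x < e → i ≤ y → y < e → (f x < f y ↔ f' x < f' y)) : IsBest f' i e b :=
  ⟨hb.1, hb.2.1, fun k hk hke hne =>
    (suf_lt_suf_iff_of_orderIso h hb.1 hk).1 (hb.2.2 k hk hke hne)⟩

theorem suf_shift (f : ℕ → ℕ) (a e d : ℕ) :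
    suf (fun x => f (x + d)) a e = suf f (a + d) (e + d) := by
  rw [suf, suf, Nat.add_sub_add_right, add_comm a d, ← List.map_add_range', List.map_map]
  congr 1
  ext x
  simp [add_comm]

theorem IsBest.shift {f : ℕ → ℕ} {i e b d : ℕ} (hb : IsBest (fun x => f (x + d)) i e b) :
    IsBest f (i + d) (e + d) (b + d) := by
  refine ⟨by have := hb.1; omega, by have := hb.2.1; omega, fun k hk hke hne => ?_⟩
  obtain ⟨k, rfl⟩ : ∃ k', k = k' + d := ⟨k - d, by omega⟩
  have := hb.2.2 k (by omega) (by omega) (by omega)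
  rwa [suf_shift, suf_shift] at this

theorem drop_take_eq_suf (T : List ℕ) {a e : ℕ} (he : e ≤ T.length) :
    (T.take e).drop a = suf (fun i => T.getD i 0) a e := by
  apply List.ext_getElem
  · simp [suf]; omega
  · intro i h1 h2
    simp [suf] at h1 h2 ⊢
    rw [List.getElem?_eq_getElem (by omega)]
    simp

theorem IsBest.isMinSuf {T : List ℕ} {ℓ r b : ℕ} (hr : r ≤ T.length)
    (hb : IsBest (fun i => T.getD i 0) (ℓ - 1) r b) :
    ∃ s, IsMinSuf (fragment T ℓ r) s ∧ r - b = s.length := by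
  have hfr : ∀ k, (fragment T ℓ r).drop k = suf (fun i => T.getD i 0) (ℓ - 1 + k) r := by
    intro k
    rw [fragment, List.drop_drop, drop_take_eq_suf T hr]
  obtain ⟨h1, h2, h3⟩ := hb
  refine ⟨suf (fun i => T.getD i 0) b r, ⟨?_, ?_, ?_⟩, by simp [suf]⟩
  · rw [suf_of_lt _ h2]; simp
  · have := hfr (b - (ℓ - 1))
    rw [show ℓ - 1 + (b - (ℓ - 1)) = b by omega] at this
    rw [← this]
    exact List.drop_suffix _ _
  · intro u hu huv
    rw [List.suffix_iff_eq_drop] at huv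
    rw [hfr] at huv
    set k := ℓ - 1 + ((fragment T ℓ r).length - u.length) with hk
    have hkr : k < r := by
      by_contra hcon
      apply hu
      rw [huv]
      simp [suf]; omega
    rw [huv]
    by_cases hkb : k = b
    · left; rw [hkb]
    · right; exact h3 k (by omega) hkr hkb

theorem isBest_succ_self (f : ℕ → ℕ) (i : ℕ) : IsBest f i (i + 1) i :=
  ⟨le_rfl, by omega, fun k h1 h2 h3 => by omega⟩

namespace ArrayLang

open WordRAM

/-! ### The table of minimal suffixes -/

/-- The digit of `v23` at the given place. -/
def digitExp (e : Exp) : Exp := (𝐯 23 >>ₑ (𝐯 3 *ₑ e)) %ₑ 𝐯 30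

/-- The letter of number `k` in the block with the given identifier. -/
def digit (w id k : ℕ) : ℕ := id / 2 ^ (w * k) % 2 ^ w

/-- Compute the length `v26` of a common prefix of the suffixes at `v24` and `v25`. -/
def matchLoop : Cmd :=
  .while ((𝐯 25 +ₑ 𝐯 26 <ₑ 𝐯 21 +ₑ 𝐥 1) &ₑ
    (digitExp (𝐯 25 +ₑ 𝐯 26) =ₑ digitExp (𝐯 24 +ₑ 𝐯 26))) (26 ::= 𝐯 26 +ₑ 𝐥 1)

/-- Compare the suffix at `v25` with the least suffix so far, which starts at `v24`. -/
def compareBody : Cmd :=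
  26 ::= 𝐥 0 ;; matchLoop ;;
  .ite ((𝐯 25 +ₑ 𝐯 26 =ₑ 𝐯 21 +ₑ 𝐥 1) |ₑ
    (digitExp (𝐯 25 +ₑ 𝐯 26) <ₑ digitExp (𝐯 24 +ₑ 𝐯 26))) (24 ::= 𝐯 25) .skip ;;
  25 ::= 𝐯 25 +ₑ 𝐥 1

/-- Compute the entry `v20` of the table. -/
def entryBody : Cmd :=
  21 ::= 𝐯 20 %ₑ 𝐯 19 ;; 22 ::= 𝐯 20 /ₑ 𝐯 19 %ₑ 𝐯 19 ;; 23 ::= 𝐯 20 /ₑ 𝐯 19 /ₑ 𝐯 19 ;;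
  24 ::= 𝐯 22 ;; 25 ::= 𝐯 22 +ₑ 𝐥 1 ;; .while (𝐯 25 <ₑ 𝐯 21 +ₑ 𝐥 1) compareBody ;;
  .put 0 (𝐯 28 +ₑ 𝐯 20) (𝐯 24) ;; 20 ::= 𝐯 20 +ₑ 𝐥 1

section table

variable {D : Dims} {s : Env} {t w g : ℕ}

theorem runs_match {id j k b : ℕ} (hW : 8 * D.len ≤ 2 ^ D.W)
    (hP : Params D.len t w g) (h3 : s.v 3 = w) (h30 : s.v 30 = 2 ^ w) (h21 : s.v 21 = j)
    (h23 : s.v 23 = id) (h24 : s.v 24 = b) (h25 : s.v 25 = k) (h26 : s.v 26 = 0) (hbk : b < k)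
    (hkj : k ≤ j) (hj : j < 2 * t) :
    Runs D matchLoop s fun s' T => T ≤ 40 * (2 * t) + 30 ∧
      ∃ m, s'.v 26 = m ∧ k + m ≤ j + 1 ∧ (∀ i < m, digit w id (k + i) = digit w id (b + i)) ∧
        (k + m = j + 1 ∨ digit w id (k + m) ≠ digit w id (b + m)) := by
  have htn := hP.t_lt
  have hbn := hP.bits_lt
  have hW0 := wordSize_ne_zero hW (by omega)
  -- The conjunction in the loop condition is not short-circuited, so digits are also read at the
  -- place `k + m = j + 1 ≤ 2 * t`, just after the range. The value found there is irrelevant; only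
  -- the shift distance has to be a word.
  have hmul : ∀ x, x ≤ 2 * t → w * x < 2 ^ D.W := fun x hx => by
    have : w * x ≤ w * (2 * t) := Nat.mul_le_mul_left _ hx
    nlinarith
  refine Runs.while (fun c s' => ∃ m, s'.v 26 = m ∧ c = j + 1 - (k + m) ∧ k + m ≤ j + 1 ∧
    ∀ i < m, digit w id (k + i) = digit w id (b + i)) 5 (j + 1 - k) ?_ ?_ ?_ ?_
  · exact ⟨0, h26, by simp, by omega, by simp⟩
  · rintro c s' hf ⟨m, hm, -, hle, -⟩
    have h3' : s'.v 3 = w := by rw [hf.v 3 (by decide), h3]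
    have h21' : s'.v 21 = j := by rw [hf.v 21 (by decide), h21]
    have h24' : s'.v 24 = b := by rw [hf.v 24 (by decide), h24]
    have h25' : s'.v 25 = k := by rw [hf.v 25 (by decide), h25]
    have h1 := hmul (k + m) (by omega)
    have h2 := hmul (b + m) (by omega)
    simp [digitExp, h3', h21', h24', h25', hm, h1, h2, hW0]
    omega
  · rintro c s' hf ⟨m, hm, hc, hle, hag⟩ hne R hR
    have h3' : s'.v 3 = w := by rw [hf.v 3 (by decide), h3]
    have h30' : s'.v 30 = 2 ^ w := by rw [hf.v 30 (by decide), h30]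
    have h21' : s'.v 21 = j := by rw [hf.v 21 (by decide), h21]
    have h23' : s'.v 23 = id := by rw [hf.v 23 (by decide), h23]
    have h24' : s'.v 24 = b := by rw [hf.v 24 (by decide), h24]
    have h25' : s'.v 25 = k := by rw [hf.v 25 (by decide), h25]
    simp only [digitExp, Exp.eval, exactValue, h3', h30', h21', h23', h24', h25', hm] at hne
    change (_ &&& (if digit w id (k + m) = digit w id (b + m) then 1 else 0)) ≠ 0 at hne
    have h1 : k + m < j + 1 := by
      by_contra hcon
      simp [hcon] at hne
    have h2 : digit w id (k + m) = digit w id (b + m) := by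
      by_contra hcon
      simp [hcon] at hne
    simp [hm, hW0]
    refine ⟨by omega, hR (j + 1 - (k + (m + 1))) _ _ (by omega) (by omega) ⟨m + 1, by simp, rfl,
      by omega, fun i hi => ?_⟩⟩
    rcases Nat.lt_succ_iff_lt_or_eq.1 hi with hi | rfl
    · exact hag i hi
    · exact h2
  · rintro c s' T hf ⟨m, hm, hc, hle, hag⟩ hz hT
    have h3' : s'.v 3 = w := by rw [hf.v 3 (by decide), h3]
    have h30' : s'.v 30 = 2 ^ w := by rw [hf.v 30 (by decide), h30]
    have h21' : s'.v 21 = j := by rw [hf.v 21 (by decide), h21]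
    have h23' : s'.v 23 = id := by rw [hf.v 23 (by decide), h23]
    have h24' : s'.v 24 = b := by rw [hf.v 24 (by decide), h24]
    have h25' : s'.v 25 = k := by rw [hf.v 25 (by decide), h25]
    simp only [digitExp, Exp.eval, exactValue, h3', h30', h21', h23', h24', h25', hm] at hz
    change (_ &&& (if digit w id (k + m) = digit w id (b + m) then 1 else 0)) = 0 at hz
    simp [digitExp] at hT
    refine ⟨by omega, m, hm, hle, hag, ?_⟩
    by_contra! hcon
    have h1 : k + m < j + 1 := by omega
    simp [h1, hcon.2] at hz

theorem runs_compare {id i j k b : ℕ} (hW : 8 * D.len ≤ 2 ^ D.W)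
    (hP : Params D.len t w g) (h3 : s.v 3 = w) (h30 : s.v 30 = 2 ^ w) (h21 : s.v 21 = j)
    (h23 : s.v 23 = id) (h24 : s.v 24 = b) (h25 : s.v 25 = k) (hib : i ≤ b) (hbk : b < k)
    (hkj : k ≤ j) (hj : j < 2 * t)
    (hb : ∀ l, i ≤ l → l < k → l ≠ b → suf (digit w id) b (j + 1) < suf (digit w id) l (j + 1)) :
    Runs D compareBody s fun s' T => T ≤ 40 * (2 * t) + 80 ∧ s'.v 25 = k + 1 ∧
      ∃ b', s'.v 24 = b' ∧ i ≤ b' ∧ b' < k + 1 ∧ ∀ l, i ≤ l → l < k + 1 → l ≠ b' →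
        suf (digit w id) b' (j + 1) < suf (digit w id) l (j + 1) := by
  have htn := hP.t_lt
  have hbn := hP.bits_lt
  have hW0 := wordSize_ne_zero hW (by omega)
  have hmul : ∀ x, x ≤ 2 * t → w * x < 2 ^ D.W := fun x hx => by
    have : w * x ≤ w * (2 * t) := Nat.mul_le_mul_left _ hx
    nlinarith
  simp only [compareBody, runs_seq, runs_asg]
  refine ⟨by simp, ?_⟩
  refine (runs_match (id := id) (j := j) (k := k) (b := b) hW hP (by simpa using h3)
    (by simpa using h30) (by simpa using h21) (by simpa using h23) (by simpa using h24)
    (by simpa using h25) (by simp) hbk hkj hj).frame.mono ?_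
  rintro s₁ T₁ ⟨hf, hT, m, hm, hle, hag, hend⟩
  have h3' : s₁.v 3 = w := by rw [hf.v 3 (by decide)]; simpa using h3
  have h30' : s₁.v 30 = 2 ^ w := by rw [hf.v 30 (by decide)]; simpa using h30
  have h21' : s₁.v 21 = j := by rw [hf.v 21 (by decide)]; simpa using h21
  have h23' : s₁.v 23 = id := by rw [hf.v 23 (by decide)]; simpa using h23
  have h24' : s₁.v 24 = b := by rw [hf.v 24 (by decide)]; simpa using h24
  have h25' : s₁.v 25 = k := by rw [hf.v 25 (by decide)]; simpa using h25
  have h1 := hmul (k + m) (by omega)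
  have h2 := hmul (b + m) (by omega)
  have hiff := suf_lt_iff hbk hle hag hend
  rw [runs_ite]
  refine ⟨?_, fun hne => ?_, fun hz => ?_⟩
  · simp [digitExp, h3', h21', h24', h25', hm, h1, h2, hW0]
    omega
  · simp only [digitExp, Exp.eval, exactValue, h3', h30', h21', h23', h24', h25', hm] at hne
    change (_ ||| (if digit w id (k + m) < digit w id (b + m) then 1 else 0)) ≠ 0 at hne
    have hlt : suf (digit w id) k (j + 1) < suf (digit w id) b (j + 1) := by
      rw [hiff]
      by_contra! hcon
      simp [hcon.1, hcon.2] at hne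
    simp [digitExp, h25', hW0]
    refine ⟨by omega, by omega, by omega, fun l hl hlk hne => ?_⟩
    by_cases hlb : l = b
    · rw [hlb]; exact hlt
    · exact hlt.trans (hb l hl (by omega) hlb)
  · simp only [digitExp, Exp.eval, exactValue, h3', h30', h21', h23', h24', h25', hm] at hz
    change (_ ||| (if digit w id (k + m) < digit w id (b + m) then 1 else 0)) = 0 at hz
    have hlt : suf (digit w id) b (j + 1) < suf (digit w id) k (j + 1) := by
      refine lt_of_le_of_ne (not_lt.1 fun hcon => ?_)
        (suf_ne (by omega) (by omega) (by omega))
      rw [Nat.or_eq_zero_iff] at hz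
      rcases hiff.1 hcon with h | h
      · simp [h] at hz
      · simp [h] at hz
    simp [digitExp, h24', h25', hW0]
    refine ⟨by omega, by omega, hib, by omega, fun l hl hlk hne => ?_⟩
    by_cases hlb : l = k
    · rw [hlb]; exact hlt
    · exact hb l hl (by omega) hne

/-- What the entries of the table have to be. -/
def TableEntry (t w x b : ℕ) : Prop :=
  b < 2 * t ∧ (x / (2 * t) % (2 * t) ≤ x % (2 * t) →
    IsBest (digit w (x / (2 * t) / (2 * t))) (x / (2 * t) % (2 * t)) (x % (2 * t) + 1) b)

/-- The index `x` encodes identifier, first offset `i` and last offset `j` in mixed radix. Each of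
the fewer than `2 * t` candidates is compared with the best one so far in time `O(t)`. For `i ≥ j`
the loop does not run and the entry is `i`, which is correct for `i = j` and never queried for `i >
j`. -/
theorem runs_entry {x off : ℕ} (hm : D.m = 8) (hW : 8 * D.len ≤ 2 ^ D.W)
    (hP : Params D.len t w g) (h3 : s.v 3 = w) (h30 : s.v 30 = 2 ^ w) (h19 : s.v 19 = 2 * t)
    (h20 : s.v 20 = x) (h28 : s.v 28 = off) (hx : off + x < D.len) {R : Env → ℕ → Prop}
    (hR : ∀ s' T b, Frame entryBody s s' → T ≤ 200 * (2 * t) ^ 2 → TableEntry t w x b →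
      s'.v 20 = x + 1 → (∀ i, s'.arr 0 i = if i = off + x then b else s.arr 0 i) → R s' T) :
    Runs D entryBody s R := by
  have htn := hP.t_lt
  have ht2 := hP.two_le
  have hW0 := wordSize_ne_zero hW (by omega)
  have hj : x % (2 * t) < 2 * t := Nat.mod_lt _ (by omega)
  have hi : x / (2 * t) % (2 * t) < 2 * t := Nat.mod_lt _ (by omega)
  set j := x % (2 * t) with hjdef
  set i := x / (2 * t) % (2 * t) with hidef
  set id := x / (2 * t) / (2 * t) with hiddef
  apply Runs.mono (Q := fun s' T => Frame entryBody s s' ∧ T ≤ 200 * (2 * t) ^ 2 ∧ ∃ b,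
    TableEntry t w x b ∧ s'.v 20 = x + 1 ∧
      (∀ i, s'.arr 0 i = if i = off + x then b else s.arr 0 i))
  swap
  · rintro s' T ⟨hf, hT, b, h1, h2, h3⟩
    exact hR s' T b hf hT h1 h2 h3
  apply Runs.frame
  simp only [entryBody, runs_seq, runs_asg]
  simp only [Exp.eval, Exp.Safe, exactValue, Fits, Env.set_v, Exp.cost]
  simp only [Nat.reduceEqDiff, if_false, if_true, h19, h20, ← hjdef, ← hidef, ← hiddef]
  refine ⟨by simp, by simp, by simp, trivial, ⟨trivial, by omega, by omega⟩, ?_⟩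
  refine Runs.while (fun c s' => ∃ k b, c = 2 * t - k ∧ s'.v 25 = k ∧ s'.v 24 = b ∧ i ≤ b ∧ b < k ∧
    k ≤ 2 * t ∧ (i ≤ j → k ≤ j + 1) ∧ ∀ l, i ≤ l → l < k → l ≠ b →
      suf (digit w id) b (j + 1) < suf (digit w id) l (j + 1))
    (40 * (2 * t) + 80) (2 * t - (i + 1)) ?_ ?_ ?_ ?_
  · exact ⟨i + 1, i, rfl, by simp, by simp, le_rfl, by omega, by omega, by omega,
      fun l h1 h2 h3 => by omega⟩
  · rintro c s' hf -
    have h21' : s'.v 21 = j := by rw [hf.v 21 (by decide)]; simp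
    simp [h21', hW0]
    omega
  · rintro c s' hf ⟨k, b, rfl, h25, h24, hib, hbk, hk2, hkj, hb⟩ hne R hR
    have h3' : s'.v 3 = w := by rw [hf.v 3 (by decide)]; simpa using h3
    have h30' : s'.v 30 = 2 ^ w := by rw [hf.v 30 (by decide)]; simpa using h30
    have h21' : s'.v 21 = j := by rw [hf.v 21 (by decide)]; simp
    have h23' : s'.v 23 = id := by rw [hf.v 23 (by decide)]; simp
    simp [h21', h25] at hne
    refine (runs_compare hW hP h3' h30' h21' h23' h24 h25 hib hbk hne hj hb).mono ?_
    rintro s₂ T₂ ⟨hT₂, h25₂, b', h24₂, hib', hbk', hb'⟩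
    exact hR (2 * t - (k + 1)) _ _ (by omega) hT₂ ⟨k + 1, b', rfl, h25₂, h24₂, hib', hbk',
      by omega, by omega, hb'⟩
  · rintro c s' T hf ⟨k, b, rfl, h25, h24, hib, hbk, hk2, hkj, hb⟩ hz hT
    have h21' : s'.v 21 = j := by rw [hf.v 21 (by decide)]; simp
    have h28' : s'.v 28 = off := by rw [hf.v 28 (by decide)]; simpa using h28
    have h20' : s'.v 20 = x := by rw [hf.v 20 (by decide)]; simpa using h20
    have h0' : s'.arr 0 = s.arr 0 := by rw [hf.arr 0 (by decide)]; simp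
    simp [h21', h25] at hz hT
    simp [hm, h28', h20', h24, hx, hW0, h0']
    refine ⟨by omega, by omega, ?_, b, ⟨by omega, fun hij => ⟨hib, ?_, fun l h1 h2 h3 => ?_⟩⟩,
      fun i => rfl⟩
    · have : (2 * t - (i + 1)) ≤ 2 * t := by omega
      have h4 : (40 * (2 * t) + 80 + 5 + 1) * (2 * t - (i + 1)) ≤ (40 * (2 * t) + 86) * (2 * t) :=
        Nat.mul_le_mul_left _ this
      nlinarith
    · rw [← hidef, ← hjdef] at hij
      have := hkj hij
      rw [← hjdef]
      omega
    · rw [← hidef, ← hjdef] at hij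
      exact hb l h1 (by omega) h3

end table

/-! ### The construction program -/

/-- Compute the block length `v2`, the bits per letter `v3`, the number `v4` of identifiers of
`v13` bits and the number `v5` of blocks per word. -/
def paramCmd : Cmd :=
  2 ::= 𝐥 1 ;; 3 ::= 𝐥 2 ;; .while (𝐯 2 <ₑ 𝐯 1) (2 ::= 𝐯 2 +ₑ 𝐯 2 ;; 3 ::= 𝐯 3 +ₑ 𝐥 1) ;;
  13 ::= (𝐯 2 +ₑ 𝐯 2) *ₑ 𝐯 3 ;; 4 ::= 𝐥 1 <<ₑ 𝐯 13 ;; 14 ::= 𝐯 4 ;; 5 ::= 𝐥 1 ;;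
  .while (𝐯 14 <ₑ 𝐯 0 /ₑ 𝐯 4 +ₑ 𝐥 1) (14 ::= 𝐯 14 *ₑ 𝐯 4 ;; 5 ::= 𝐯 5 +ₑ 𝐥 1)

theorem runs_param {D : Dims} {s : Env} {τ t w : ℕ} (hW : 8 * D.len ≤ 2 ^ D.W) (hτ : 2 ≤ τ)
    (ht : t = 2 ^ Nat.clog 2 τ) (hw : w = Nat.clog 2 τ + 2)
    (hM : (2 ^ (2 * t * w)) ^ 4 ≤ D.len) (h0 : s.v 0 = D.len) (h1 : s.v 1 = τ) :
    Runs D paramCmd s fun s' T => Frame paramCmd s s' ∧ T ≤ 100 * D.len ∧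
      ∃ g, Params D.len t w g ∧ s'.v 2 = t ∧ s'.v 3 = w ∧ s'.v 4 = 2 ^ (2 * t * w) ∧
        s'.v 5 = g ∧ s'.v 13 = 2 * t * w := by
  have hc : 1 ≤ Nat.clog 2 τ := (Nat.lt_clog_iff_pow_lt (by omega)).2 (by simp; omega)
  have ht2 : 2 ≤ t := by
    rw [ht]; exact Nat.le_self_pow (by omega) 2
  have hpow : 2 ^ w = 4 * t := by rw [hw, ht, pow_add]; ring
  have hb8 : 8 * t * w < D.len := by
    rw [← pow_mul] at hM
    have : 2 * t * w * 4 < D.len := Nat.lt_two_pow_self.trans_le hM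
    linarith
  have hb2 : 2 * t * w < D.len := lt_of_le_of_lt (by nlinarith) hb8
  have hw3 : 3 ≤ w := by omega
  have htn : 24 * t < D.len := by nlinarith
  have hwn : 16 * w < D.len := by nlinarith
  have hW0 := wordSize_ne_zero hW (by omega)
  have hM2 : 2 ≤ 2 ^ (2 * t * w) := Nat.le_self_pow (by positivity) 2
  have hMn : 2 ^ (2 * t * w) ≤ D.len := le_trans (Nat.le_self_pow (by omega) _) hM
  apply Runs.frame
  simp only [paramCmd, runs_seq, runs_asg]
  refine ⟨by simp [hW0], ⟨show 2 < 2 ^ D.W by omega, ?_⟩⟩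
  refine Runs.while (fun k s' => ∃ i ≤ Nat.clog 2 τ, k = Nat.clog 2 τ - i ∧ s'.v 2 = 2 ^ i ∧
    s'.v 3 = i + 2) 8 (Nat.clog 2 τ) ?_ ?_ ?_ ?_
  · exact ⟨0, by omega, by simp, by simp, by simp⟩
  · simp
  · rintro k s' hf ⟨i, hi, rfl, h2, h3⟩ hne R hR
    have h1' : s'.v 1 = τ := by rw [hf.v 1 (by decide)]; simpa using h1
    simp [h1', h2] at hne
    have hi' : i + 1 ≤ Nat.clog 2 τ := (Nat.lt_clog_iff_pow_lt (by omega)).2 hne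
    have hle : 2 ^ (i + 1) ≤ t := by rw [ht]; exact Nat.pow_le_pow_right (by omega) hi'
    rw [pow_succ] at hle
    simp [h2, h3, hW0]
    refine ⟨by omega, by omega, hR (Nat.clog 2 τ - (i + 1)) _ _ (by omega) (by omega)
      ⟨i + 1, hi', rfl, ?_, by simp⟩⟩
    simp [pow_succ]; ring
  · rintro k s' T hf ⟨i, hi, rfl, h2, h3⟩ hz hT
    have h1' : s'.v 1 = τ := by rw [hf.v 1 (by decide)]; simpa using h1
    have h0' : s'.v 0 = D.len := by rw [hf.v 0 (by decide)]; simpa using h0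
    simp [h1', h2] at hz hT
    have hi' : i = Nat.clog 2 τ := le_antisymm hi ((Nat.clog_le_iff_le_pow (by omega)).2 hz)
    rw [hi', ← ht] at h2
    rw [hi', ← hw] at h3
    have htt : (t + t) * w = 2 * t * w := by ring
    simp only [Exp.eval, Exp.Safe, exactValue, Fits, Env.set_v, Exp.cost]
    simp only [Nat.reduceEqDiff, if_false, if_true, h2, h3, htt, one_mul]
    refine ⟨⟨⟨trivial, trivial, by omega⟩, trivial, by omega⟩, ⟨by omega, trivial, by omega⟩,
      trivial, by omega, ?_⟩
    -- The condition tests `M ^ g ≤ n / M` instead of `M ^ (g + 1) ≤ n`, so the product is formed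
    -- only when it is known to be at most `n`. The crude variant `n - M ^ g` suffices for a linear
    -- time bound.
    refine Runs.while (fun k s₂ => ∃ g, 1 ≤ g ∧ s₂.v 5 = g ∧ s₂.v 14 = (2 ^ (2 * t * w)) ^ g ∧
      (2 ^ (2 * t * w)) ^ g ≤ D.len ∧ k = D.len - (2 ^ (2 * t * w)) ^ g) 8
      (D.len - 2 ^ (2 * t * w)) ?_ ?_ ?_ ?_
    · exact ⟨1, le_rfl, by simp, by simp, by simpa using hMn, by simp⟩
    · rintro k s₂ hf₂ -
      have h0₂ : s₂.v 0 = D.len := by rw [hf₂.v 0 (by decide)]; simpa using h0'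
      have h4₂ : s₂.v 4 = 2 ^ (2 * t * w) := by rw [hf₂.v 4 (by decide)]; simp
      have := Nat.div_le_self D.len (2 ^ (2 * t * w))
      simp [h0₂, h4₂, hW0]
      omega
    · rintro k s₂ hf₂ ⟨g, hg, h5, h14, hle, rfl⟩ hne R hR
      have h0₂ : s₂.v 0 = D.len := by rw [hf₂.v 0 (by decide)]; simpa using h0'
      have h4₂ : s₂.v 4 = 2 ^ (2 * t * w) := by rw [hf₂.v 4 (by decide)]; simp
      simp only [Exp.eval, exactValue, h14, h0₂, h4₂, ne_eq, ite_eq_right_iff, one_ne_zero,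
        imp_false, not_not, Nat.lt_succ_iff,
        Nat.le_div_iff_mul_le (show 0 < 2 ^ (2 * t * w) by positivity),
        ← pow_succ] at hne
      have hgrow : (2 ^ (2 * t * w)) ^ g < (2 ^ (2 * t * w)) ^ (g + 1) :=
        Nat.pow_lt_pow_right (by omega) (by omega)
      have hgn : g < D.len := (Nat.lt_pow_self (by omega)).trans_le hle
      simp only [runs_seq, runs_asg]
      simp only [Exp.eval, Exp.Safe, exactValue, Fits, Env.set_v, Exp.cost]
      simp only [Nat.reduceEqDiff, if_false, h14, h4₂, h5, ← pow_succ]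
      refine ⟨⟨trivial, trivial, by omega⟩, ⟨trivial, by omega, by omega⟩,
        hR (D.len - (2 ^ (2 * t * w)) ^ (g + 1)) _ _ (by omega) (by omega)
        ⟨g + 1, by omega, by simp, by simp, hne, rfl⟩⟩
    · rintro k s₂ T₂ hf₂ ⟨g, hg, h5, h14, hle, rfl⟩ hz hT₂
      have h0₂ : s₂.v 0 = D.len := by rw [hf₂.v 0 (by decide)]; simpa using h0'
      have h4₂ : s₂.v 4 = 2 ^ (2 * t * w) := by rw [hf₂.v 4 (by decide)]; simp
      simp only [Exp.eval, exactValue, h14, h0₂, h4₂, ite_eq_right_iff, one_ne_zero, imp_false,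
        Nat.lt_succ_iff, Nat.le_div_iff_mul_le (show 0 < 2 ^ (2 * t * w) by positivity),
        ← pow_succ] at hz
      refine ⟨?_, g, ⟨ht2, hpow, hM, hg, hle, by omega⟩, ?_, ?_, h4₂, h5, ?_⟩
      · simp at hT₂ ⊢
        omega
      · rw [hf₂.v 2 (by decide)]; simpa using h2
      · rw [hf₂.v 3 (by decide)]; simpa using h3
      · rw [hf₂.v 13 (by decide)]; simp

/-- The number of words that store the identifiers of the blocks. -/
def wordCount (n t g : ℕ) : ℕ := (n / t + 1) / g + 1

/-- The right side is `(4 * t) ^ (2 * t)`, and `2 * t ≥ 4`. -/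
theorem Params.pow_le {n t w g : ℕ} (h : Params n t w g) : (4 * t) ^ 4 ≤ 2 ^ (2 * t * w) := by
  have h2 := h.two_le
  rw [mul_comm (2 * t) w, pow_mul, h.pow]
  exact Nat.pow_le_pow_right (by omega) (by omega)

theorem Params.sq_mul_le {n t w g : ℕ} (h : Params n t w g) :
    16 * (2 * t) ^ 4 ≤ 2 ^ (2 * t * w) := by
  have := h.pow_le
  calc 16 * (2 * t) ^ 4 = (4 * t) ^ 4 := by ring
    _ ≤ _ := this

/-- Up to a constant, the left side is the time needed for the whole table: the number of entries
times the `(2 * t) ^ 2` steps for one entry. -/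
theorem Params.table_le {n t w g : ℕ} (h : Params n t w g) :
    2 ^ (2 * t * w) * (2 * t) * (2 * t) * (2 * t) ^ 2 ≤ (2 ^ (2 * t * w)) ^ 2 := by
  have := h.sq_mul_le
  calc 2 ^ (2 * t * w) * (2 * t) * (2 * t) * (2 * t) ^ 2 = 2 ^ (2 * t * w) * (2 * t) ^ 4 := by ring
    _ ≤ 2 ^ (2 * t * w) * 2 ^ (2 * t * w) := Nat.mul_le_mul_left _ (by omega)
    _ = _ := by ring

theorem Params.sq_le {n t w g : ℕ} (h : Params n t w g) : 4096 * (2 ^ (2 * t * w)) ^ 2 ≤ n := by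
  have h1 := h.pow_four_le
  have h2 := h.pow_le
  have h3 : (4 * 2) ^ 4 ≤ (4 * t) ^ 4 :=
    Nat.pow_le_pow_left (Nat.mul_le_mul_left _ h.two_le) _
  set M := 2 ^ (2 * t * w)
  have h4 : 4096 ≤ M := by norm_num at h3; omega
  have h5 : 4096 ≤ M ^ 2 := by nlinarith
  calc 4096 * M ^ 2 ≤ M ^ 2 * M ^ 2 := Nat.mul_le_mul_right _ h5
    _ = M ^ 4 := by ring
    _ ≤ n := h1

/-- The data structure overwrites the text in array `0`, so it has to fit into `n` cells. The
identifiers take at most `n / 2 + 2` of them, and the table at most `n / 4096` by `Params.sq_le`. -/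
theorem Params.size_le {n t w g : ℕ} (h : Params n t w g) :
    wordCount n t g + 6 + 2 ^ (2 * t * w) * (2 * t) * (2 * t) ≤ n := by
  have h1 := h.sq_le
  have h2 := h.table_le
  have h3 := h.two_le
  have h4 := h.t_lt
  have h5 : 2 ^ (2 * t * w) * (2 * t) * (2 * t) ≤ (2 ^ (2 * t * w)) ^ 2 :=
    le_trans (Nat.le_mul_of_pos_right _ (by positivity)) h2
  have h6 : n / t ≤ n / 2 := Nat.div_le_div_left h3 (by omega)
  have h7 : (n / t + 1) / g ≤ n / t + 1 := Nat.div_le_self _ _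
  have h8 : 1 ≤ (2 ^ (2 * t * w)) ^ 2 := Nat.one_le_pow _ _ (by positivity)
  unfold wordCount
  omega

/-- The contents of the data structure: parameters, identifiers of blocks, table. -/
structure Built (n t w g : ℕ) (val : ℕ → ℕ → ℕ) (A : ℕ → ℕ) : Prop where
  cell_zero : A 0 = t
  cell_one : A 1 = g
  cell_two : A 2 = 2 * t * w
  cell_three : A 3 = 2 ^ (2 * t * w)
  cell_four : A 4 = 2 * t
  cell_five : A 5 = wordCount n t g + 6
  words : ∀ q < wordCount n t g, A (q + 6) = packed t w g val q
  table : ∀ x < 2 ^ (2 * t * w) * (2 * t) * (2 * t),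
    TableEntry t w x (A (wordCount n t g + 6 + x))

/-- Assemble the data structure at the beginning of array `0` and leave its size in `v0`. -/
def finishCmd : Cmd :=
  19 ::= 𝐯 2 +ₑ 𝐯 2 ;; 30 ::= 𝐯 19 +ₑ 𝐯 19 ;; 29 ::= (𝐯 0 /ₑ 𝐯 2 +ₑ 𝐥 1) /ₑ 𝐯 5 +ₑ 𝐥 1 ;;
  28 ::= 𝐯 29 +ₑ 𝐥 6 ;; 27 ::= 𝐯 4 *ₑ 𝐯 19 *ₑ 𝐯 19 ;;
  8 ::= 𝐥 0 ;; .while (𝐯 8 <ₑ 𝐯 29) (.put 0 (𝐯 8 +ₑ 𝐥 6) (.get 6 (𝐯 8)) ;; 8 ::= 𝐯 8 +ₑ 𝐥 1) ;;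
  20 ::= 𝐥 0 ;; .while (𝐯 20 <ₑ 𝐯 27) entryBody ;;
  .put 0 (𝐥 0) (𝐯 2) ;; .put 0 (𝐥 1) (𝐯 5) ;; .put 0 (𝐥 2) (𝐯 13) ;;
  .put 0 (𝐥 3) (𝐯 4) ;; .put 0 (𝐥 4) (𝐯 19) ;; .put 0 (𝐥 5) (𝐯 28) ;; 0 ::= 𝐯 28 +ₑ 𝐯 27

theorem runs_finish {D : Dims} {s : Env} {t w g : ℕ} {val : ℕ → ℕ → ℕ} (hm : D.m = 8)
    (hW : 8 * D.len ≤ 2 ^ D.W) (hP : Params D.len t w g) (h0 : s.v 0 = D.len) (h2 : s.v 2 = t)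
    (h3 : s.v 3 = w) (h4 : s.v 4 = 2 ^ (2 * t * w)) (h5 : s.v 5 = g) (h13 : s.v 13 = 2 * t * w)
    (h6 : ∀ q, s.arr 6 q = packed t w g val q) :
    Runs D finishCmd s fun s' T => T ≤ 300 * D.len ∧ Built D.len t w g val (s'.arr 0) ∧
      s'.v 0 = wordCount D.len t g + 6 + 2 ^ (2 * t * w) * (2 * t) * (2 * t) := by
  have ht2 := hP.two_le
  have htn := hP.t_lt
  have hW0 := wordSize_ne_zero hW (by omega)
  have hsize := hP.size_le
  have htt : t + t = 2 * t := by ring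
  have hq : 2 * t + 2 * t = 2 ^ w := by rw [hP.pow]; ring
  have hpw := hP.pow
  have hdiv : D.len / t ≤ D.len := Nat.div_le_self _ _
  have hdiv' : (D.len / t + 1) / g ≤ D.len / t + 1 := Nat.div_le_self _ _
  obtain ⟨P, hPdef⟩ : ∃ P, wordCount D.len t g = P := ⟨_, rfl⟩
  have hwc : (D.len / t + 1) / g + 1 = P := hPdef
  obtain ⟨M, hM⟩ : ∃ M, 2 ^ (2 * t * w) = M := ⟨_, rfl⟩
  have htab := hP.table_le
  have hsq := hP.sq_le
  rw [hPdef] at hsize ⊢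
  rw [hM] at h4 hsize htab hsq ⊢
  have hM2 : M * (2 * t) ≤ M * (2 * t) * (2 * t) := Nat.le_mul_of_pos_right _ (by omega)
  simp only [finishCmd, runs_seq, runs_asg]
  simp only [Exp.eval, Exp.Safe, exactValue, Fits, Env.set_v, Exp.cost]
  simp only [Nat.reduceEqDiff, if_false, if_true, h2, h0, h5, h4, htt, hq, hwc]
  refine ⟨⟨trivial, trivial, by omega⟩, ⟨trivial, trivial, by omega⟩,
    ⟨⟨⟨⟨trivial, trivial, trivial⟩, by omega, by omega⟩, trivial, trivial⟩, by omega, by omega⟩,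
    ⟨trivial, by omega, by omega⟩, ⟨⟨trivial, trivial, by omega⟩, trivial, by omega⟩, by omega, ?_⟩
  refine Runs.while (fun k s' => s'.v 8 ≤ P ∧ k = P - s'.v 8 ∧
    ∀ q < s'.v 8, s'.arr 0 (q + 6) = packed t w g val q) 14 P ?_ ?_ ?_ ?_
  · simp
  · simp
  · rintro k s' hf ⟨h8, rfl, hA⟩ hne R hR
    have h29 : s'.v 29 = P := by rw [hf.v 29 (by decide)]; simp
    have h6' : s'.arr 6 = s.arr 6 := by rw [hf.arr 6 (by decide)]; simp
    simp [h29] at hne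
    simp [hm, hW0, h6', h6]
    refine ⟨⟨by omega, by omega⟩, by omega, by omega, by omega, hR (P - (s'.v 8 + 1)) _ _ (by omega)
      (by omega) ⟨by simp; omega, by simp, fun q hq => ?_⟩⟩
    simp at hq ⊢
    split_ifs with hq'
    · rw [hq']
    · exact hA q (by omega)
  · rintro k s₁ T₁ hf ⟨h8, rfl, hA⟩ hz hT₁
    have h29 : s₁.v 29 = P := by rw [hf.v 29 (by decide)]; simp
    simp [h29] at hz hT₁
    rw [le_antisymm h8 hz] at hA
    refine ⟨by omega, ?_⟩
    refine Runs.while (fun k s' => s'.v 20 ≤ M * (2 * t) * (2 * t) ∧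
      k = M * (2 * t) * (2 * t) - s'.v 20 ∧ (∀ q < P, s'.arr 0 (q + 6) = packed t w g val q) ∧
      ∀ x < s'.v 20, TableEntry t w x (s'.arr 0 (P + 6 + x))) (200 * (2 * t) ^ 2)
      (M * (2 * t) * (2 * t)) ?_ ?_ ?_ ?_
    · exact ⟨by simp, by simp, by simpa using hA, by simp⟩
    · simp
    · rintro k s' hf' ⟨h20, rfl, hA', hB⟩ hne R hR
      have h27 : s'.v 27 = M * (2 * t) * (2 * t) := by
        rw [hf'.v 27 (by decide), Env.set_v, hf.v 27 (by decide)]; simp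
      have h28 : s'.v 28 = P + 6 := by
        rw [hf'.v 28 (by decide), Env.set_v, hf.v 28 (by decide)]; simp
      have h19 : s'.v 19 = 2 * t := by
        rw [hf'.v 19 (by decide), Env.set_v, hf.v 19 (by decide)]; simp
      have h30 : s'.v 30 = 2 ^ w := by
        rw [hf'.v 30 (by decide), Env.set_v, hf.v 30 (by decide)]; simp
      have h3' : s'.v 3 = w := by
        rw [hf'.v 3 (by decide), Env.set_v, hf.v 3 (by decide)]; simpa using h3
      simp [h27] at hne
      refine runs_entry hm hW hP h3' h30 h19 rfl h28 (by omega) ?_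
      intro s₂ T₂ b hf₂ hT₂ hb h20₂ h0₂
      refine hR (M * (2 * t) * (2 * t) - (s'.v 20 + 1)) _ _ (by omega) hT₂
        ⟨by omega, by rw [h20₂], fun q hq => ?_, fun x hx => ?_⟩
      · rw [h0₂, if_neg (by omega)]
        exact hA' q hq
      · rw [h0₂]
        by_cases hx' : x = s'.v 20
        · rw [if_pos (by omega), hx']; exact hb
        · rw [if_neg (by omega)]; exact hB x (by omega)
    · rintro k s₂ T₂ hf₂ ⟨h20, rfl, hA₂, hB⟩ hz hT₂
      have h27 : s₂.v 27 = M * (2 * t) * (2 * t) := by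
        rw [hf₂.v 27 (by decide), Env.set_v, hf.v 27 (by decide)]; simp
      have h28 : s₂.v 28 = P + 6 := by
        rw [hf₂.v 28 (by decide), Env.set_v, hf.v 28 (by decide)]; simp
      have h19 : s₂.v 19 = 2 * t := by
        rw [hf₂.v 19 (by decide), Env.set_v, hf.v 19 (by decide)]; simp
      have h2' : s₂.v 2 = t := by
        rw [hf₂.v 2 (by decide), Env.set_v, hf.v 2 (by decide)]; simpa using h2
      have h5' : s₂.v 5 = g := by
        rw [hf₂.v 5 (by decide), Env.set_v, hf.v 5 (by decide)]; simpa using h5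
      have h4' : s₂.v 4 = M := by
        rw [hf₂.v 4 (by decide), Env.set_v, hf.v 4 (by decide)]; simpa using h4
      have h13' : s₂.v 13 = 2 * t * w := by
        rw [hf₂.v 13 (by decide), Env.set_v, hf.v 13 (by decide)]; simpa using h13
      simp [h27] at hz hT₂
      rw [le_antisymm h20 hz] at hB
      have hX : (200 * (2 * t) ^ 2 + 3 + 1) * (M * (2 * t) * (2 * t)) ≤ 204 * M ^ 2 := by
        have : 4 * (M * (2 * t) * (2 * t)) ≤ 4 * (M * (2 * t) * (2 * t) * (2 * t) ^ 2) :=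
          Nat.mul_le_mul_left _ (Nat.le_mul_of_pos_right _ (by positivity))
        calc _ = 200 * (M * (2 * t) * (2 * t) * (2 * t) ^ 2) +
              4 * (M * (2 * t) * (2 * t)) := by ring
          _ ≤ 204 * M ^ 2 := by omega
      simp only [runs_put]
      simp [hm, h28, h27, h19, h2', h5', h4', h13', hW0]
      refine ⟨by omega, by omega, by omega, by omega, by omega, by omega, by omega, by omega,
        by omega, by omega, by omega, by omega, ?_⟩
      constructor <;> simp [hPdef, hM]
      · exact hA₂
      · intro x hx
        rw [if_neg (by omega), if_neg (by omega), if_neg (by omega), if_neg (by omega),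
          if_neg (by omega)]
        exact hB x hx

/-- The construction: `v0` and `v1` hold `n` and `τ`. -/
def buildCmd : Cmd :=
  .ite (𝐯 1 <ₑ 𝐥 2) (0 ::= 𝐥 0) (paramCmd ;; sortCmd ;; sweepCmd ;; finishCmd)

theorem runs_build {D : Dims} {s : Env} {key : ℕ → ℕ} {τ t w c : ℕ} (hm : D.m = 8)
    (hW : 8 * D.len ≤ 2 ^ D.W) (hτ : 2 ≤ τ) (ht : t = 2 ^ Nat.clog 2 τ) (hw : w = Nat.clog 2 τ + 2)
    (hM : (2 ^ (2 * t * w)) ^ 4 ≤ D.len) (h0 : s.v 0 = D.len) (h1 : s.v 1 = τ)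
    (hT : ∀ p < D.len, s.arr 0 p = key p) (hkey : ∀ p < D.len, key p < 2 ^ D.W)
    (hc : ∀ p < D.len, key p < D.len ^ c) (hz : ∀ k, 1 ≤ k → s.arr k = 0) :
    Runs D buildCmd s fun s' T => T ≤ 1100 * (c + 1) * D.len ∧
      ∃ (g : ℕ) (S : ℕ → Finset ℕ) (val : ℕ → ℕ → ℕ), Params D.len t w g ∧
        (∀ J, ∃ cnt last, Ranked (fun k => key (J * t + k - t)) (S J) (val J) cnt last) ∧
        (∀ J, ∀ k < 2 * t, t ≤ J * t + k → J * t + k - t < D.len → k ∈ S J) ∧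
        (∀ J k, val J k < 2 ^ w) ∧ Built D.len t w g val (s'.arr 0) ∧
        s'.v 0 = wordCount D.len t g + 6 + 2 ^ (2 * t * w) * (2 * t) * (2 * t) := by
  have hlen : 0 < D.len := lt_of_lt_of_le (by positivity) hM
  have hW0 := wordSize_ne_zero hW hlen
  simp only [buildCmd, runs_ite]
  refine ⟨⟨trivial, show 2 < 2 ^ D.W by omega, trivial⟩, fun hne => ?_, fun _ => ?_⟩
  · simp [h1] at hne
    omega
  simp only [runs_seq]
  refine (runs_param hW hτ ht hw hM h0 h1).mono ?_
  rintro s₁ T₁ ⟨hf₁, hT₁, g, hP, h2, h3, h4, h5, h13⟩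
  have h0₁ : s₁.v 0 = D.len := by rw [hf₁.v 0 (by decide), h0]
  have ha₁ : ∀ k, s₁.arr k = s.arr k := fun k => hf₁.arr k (by
    simp [paramCmd, Cmd.arrays])
  refine (runs_sort (key := key) (c := c) hm hW hlen h0₁ (by simpa [ha₁] using hT) hkey hc
    (by simp [ha₁, hz])).mono ?_
  rintro s₂ T₂ ⟨hf₂, hT₂, L, hL, hA, hsort⟩
  have hv₂ : ∀ x, x ∉ sortCmd.vars → s₂.v x = s₁.v x := hf₂.v
  refine (runs_sweep (key := key) (L := L) hm hW hP (by rw [hv₂ 0 (by decide), h0₁])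
    (by rw [hv₂ 2 (by decide), h2]) (by rw [hv₂ 3 (by decide), h3]) (by rw [hv₂ 5 (by decide), h5])
    (by rw [hf₂.arr 0 (by decide), ha₁]; exact hT) hL hA hsort
    (by rw [hf₂.arr 4 (by decide), ha₁, hz 4 (by omega)])
    (by rw [hf₂.arr 5 (by decide), ha₁, hz 5 (by omega)])
    (by rw [hf₂.arr 6 (by decide), ha₁, hz 6 (by omega)])).mono ?_
  rintro s₃ T₃ ⟨hf₃, hT₃, S, val, hS, hmem⟩
  have hv₃ : ∀ x, x ∉ sweepCmd.vars → s₃.v x = s₂.v x := hf₃.v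
  refine (runs_finish (val := val) hm hW hP (by rw [hv₃ 0 (by decide), hv₂ 0 (by decide), h0₁])
    (by rw [hv₃ 2 (by decide), hv₂ 2 (by decide), h2])
    (by rw [hv₃ 3 (by decide), hv₂ 3 (by decide), h3])
    (by rw [hv₃ 4 (by decide), hv₂ 4 (by decide), h4])
    (by rw [hv₃ 5 (by decide), hv₂ 5 (by decide), h5])
    (by rw [hv₃ 13 (by decide), hv₂ 13 (by decide), h13]) hS.packed).mono ?_
  rintro s₄ T₄ ⟨hT₄, hB, h0₄⟩
  refine ⟨?_, g, S, val, hP, fun J => ⟨_, _, hS.ranked J⟩, hmem, hS.val_lt hP, hB, h0₄⟩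
  have h24 := hP.t_lt
  have h22 := hP.two_le
  simp only [Exp.cost]
  nlinarith

/-! ### The query program -/

theorem sum_mul_pow_div_mod {B i m : ℕ} : ∀ {a : ℕ → ℕ}, (∀ k < m, a k < B) → i < m →
    (∑ k ∈ Finset.range m, a k * B ^ k) / B ^ i % B = a i := by
  induction i generalizing m with
  | zero =>
    intro a h hi
    obtain ⟨m, rfl⟩ : ∃ m', m = m' + 1 := ⟨m - 1, by omega⟩
    rw [Finset.sum_range_succ']
    have : ∀ k ∈ Finset.range m, a (k + 1) * B ^ (k + 1) = B * (a (k + 1) * B ^ k) := by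
      intro k _; ring
    rw [Finset.sum_congr rfl this, ← Finset.mul_sum]
    simp [Nat.mod_eq_of_lt (h 0 hi)]
  | succ i ih =>
    intro a h hi
    obtain ⟨m, rfl⟩ : ∃ m', m = m' + 1 := ⟨m - 1, by omega⟩
    rw [Finset.sum_range_succ']
    have : ∀ k ∈ Finset.range m, a (k + 1) * B ^ (k + 1) = B * (a (k + 1) * B ^ k) := by
      intro k _; ring
    have h0 := h 0 (by omega)
    rw [Finset.sum_congr rfl this, ← Finset.mul_sum, pow_succ', ← Nat.div_div_eq_div_mul,
      pow_zero, mul_one, add_comm, Nat.add_mul_div_left _ _ (by omega), Nat.div_eq_of_lt h0,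
      zero_add]
    exact ih (a := fun k => a (k + 1)) (fun k hk => h (k + 1) (by omega)) (by omega)

theorem digit_blockId {t w k : ℕ} {val : ℕ → ℕ} (h : ∀ k < 2 * t, val k < 2 ^ w) (hk : k < 2 * t) :
    digit w (blockId t w val) k = val k := by
  rw [digit, pow_mul]
  exact sum_mul_pow_div_mod h hk

theorem packed_div_mod {t w g : ℕ} {val : ℕ → ℕ → ℕ} (hg : 1 ≤ g)
    (h : ∀ J, ∀ k < 2 * t, val J k < 2 ^ w) (J : ℕ) :
    packed t w g val (J / g) / 2 ^ (2 * t * w * (J % g)) % 2 ^ (2 * t * w) =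
      blockId t w (val J) := by
  rw [pow_mul, packed, sum_mul_pow_div_mod (fun r _ => blockId_lt (h _)) (Nat.mod_lt _ hg),
    mul_comm, Nat.div_add_mod]

theorem Ranked.lt_iff {ltr val : ℕ → ℕ} {S : Finset ℕ} {cnt last : ℕ}
    (h : Ranked ltr S val cnt last) {k l : ℕ} (hk : k ∈ S) (hl : l ∈ S) :
    val k < val l ↔ ltr k < ltr l := by
  refine ⟨fun hv => ?_, h.mono k hk l hl⟩
  by_contra hcon
  rcases (not_lt.1 hcon).lt_or_eq with h1 | h1
  · have := h.mono l hl k hk h1; omega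
  · have := h.congr l hl k hk h1; omega

theorem Built.congr {n t w g : ℕ} {val : ℕ → ℕ → ℕ} {A A' : ℕ → ℕ} (h : Built n t w g val A)
    (hA : ∀ a < wordCount n t g + 6 + 2 ^ (2 * t * w) * (2 * t) * (2 * t), A' a = A a) :
    Built n t w g val A' where
  cell_zero := by rw [hA _ (by omega), h.cell_zero]
  cell_one := by rw [hA _ (by omega), h.cell_one]
  cell_two := by rw [hA _ (by omega), h.cell_two]
  cell_three := by rw [hA _ (by omega), h.cell_three]
  cell_four := by rw [hA _ (by omega), h.cell_four]
  cell_five := by rw [hA _ (by omega), h.cell_five]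
  words q hq := by rw [hA _ (by omega), h.words q hq]
  table x hx := by rw [hA _ (by omega)]; exact h.table x hx

/-- The query: `v0` and `v1` hold `ℓ` and `r`; the answer is left in `v0`. -/
def queryCmd : Cmd :=
  .ite (𝐯 0 =ₑ 𝐯 1) (0 ::= 𝐥 1)
    (2 ::= .get 0 (𝐥 0) ;; 3 ::= 𝐯 0 -ₑ 𝐥 1 ;; 4 ::= 𝐯 3 /ₑ 𝐯 2 +ₑ 𝐥 1 ;; 5 ::= 𝐯 3 %ₑ 𝐯 2 ;;
     6 ::= 𝐯 5 +ₑ (𝐯 1 -ₑ 𝐯 0) ;; 7 ::= .get 0 (𝐥 1) ;;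
     8 ::= (.get 0 (𝐯 4 /ₑ 𝐯 7 +ₑ 𝐥 6) >>ₑ (.get 0 (𝐥 2) *ₑ (𝐯 4 %ₑ 𝐯 7))) %ₑ .get 0 (𝐥 3) ;;
     9 ::= .get 0 (.get 0 (𝐥 5) +ₑ ((𝐯 8 *ₑ .get 0 (𝐥 4) +ₑ 𝐯 5) *ₑ .get 0 (𝐥 4) +ₑ 𝐯 6)) ;;
     0 ::= 𝐯 6 +ₑ 𝐥 1 -ₑ 𝐯 9)

/-- The position `ℓ - 1` lies in the first half of block `J = (ℓ - 1) / t + 1`, at offset `i = (ℓ -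
1) % t`. As `r - ℓ + 1 ≤ t`, the last offset `j = i + (r - ℓ)` is still below `2 * t`. All offsets
in between are positions of the text, so their ranks are ordered like their letters, and the table
entry for the ranks is also the answer for the letters, shifted by the start of the block. -/
theorem runs_query {D : Dims} {s : Env} {key : ℕ → ℕ} {n t w g ℓ r : ℕ} {S : ℕ → Finset ℕ}
    {val : ℕ → ℕ → ℕ} (hm : D.m = 1) (hW : 8 * n ≤ 2 ^ D.W) (hP : Params n t w g)
    (hlen : D.len = wordCount n t g + 6 + 2 ^ (2 * t * w) * (2 * t) * (2 * t))
    (hR : ∀ J, ∃ cnt last, Ranked (fun k => key (J * t + k - t)) (S J) (val J) cnt last)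
    (hS : ∀ J, ∀ k < 2 * t, t ≤ J * t + k → J * t + k - t < n → k ∈ S J)
    (hval : ∀ J k, val J k < 2 ^ w) (hB : Built n t w g val (s.arr 0))
    (h0 : s.v 0 = ℓ) (h1 : s.v 1 = r) (hℓ : 1 ≤ ℓ) (hℓr : ℓ < r) (hr : r ≤ n)
    (hτ : r - ℓ + 1 ≤ t) :
    Runs D queryCmd s fun s' T => T ≤ 100 ∧ ∃ b, IsBest key (ℓ - 1) r b ∧ s'.v 0 = r - b := by
  have ht2 := hP.two_le
  have htn := hP.t_lt
  have hW0 := wordSize_ne_zero hW (by omega)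
  have hsize := hP.size_le
  have hbits := hP.shift_lt
  have hgpos := hP.g_pos
  have hMn : 2 ^ (2 * t * w) ≤ n := le_trans (Nat.le_self_pow (by omega) _) hP.pow_four_le
  obtain ⟨J, hJ⟩ : ∃ J, (ℓ - 1) / t + 1 = J := ⟨_, rfl⟩
  obtain ⟨i, hi⟩ : ∃ i, (ℓ - 1) % t = i := ⟨_, rfl⟩
  obtain ⟨j, hj⟩ : ∃ j, i + (r - ℓ) = j := ⟨_, rfl⟩
  have hit : i < t := by rw [← hi]; exact Nat.mod_lt _ (by omega)
  have hdm := Nat.div_add_mod (ℓ - 1) t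
  rw [hi, mul_comm] at hdm
  have hJt : J * t = (ℓ - 1) / t * t + t := by rw [← hJ]; ring
  have hJn : J ≤ n / t + 1 := by
    rw [← hJ]; exact Nat.add_le_add_right (Nat.div_le_div_right (by omega)) 1
  have hnt : n / t ≤ n := Nat.div_le_self _ _
  have hJg : J / g < wordCount n t g := Nat.lt_succ_of_le (Nat.div_le_div_right hJn)
  have hword := hB.words _ hJg
  obtain ⟨id, hid⟩ : ∃ id, blockId t w (val J) = id := ⟨_, rfl⟩
  have hidlt : id < 2 ^ (2 * t * w) := by rw [← hid]; exact blockId_lt fun k _ => hval J k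
  have hext := packed_div_mod hgpos (fun J k _ => hval J k) J (t := t)
  rw [hid] at hext
  have hsh : 2 * t * w * (J % g) < n :=
    lt_of_le_of_lt (Nat.mul_le_mul_left _ (Nat.mod_lt J hgpos).le) hbits
  obtain ⟨x, hx⟩ : ∃ x, (id * (2 * t) + i) * (2 * t) + j = x := ⟨_, rfl⟩
  have hx1 : x % (2 * t) = j := by
    rw [← hx, mul_comm, Nat.mul_add_mod, Nat.mod_eq_of_lt (by omega)]
  have hxd : x / (2 * t) = id * (2 * t) + i := by
    rw [← hx, add_comm, Nat.add_mul_div_right _ _ (by omega), Nat.div_eq_of_lt (by omega), zero_add]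
  have hx2 : x / (2 * t) % (2 * t) = i := by
    rw [hxd, mul_comm, Nat.mul_add_mod, Nat.mod_eq_of_lt (by omega)]
  have hx3 : x / (2 * t) / (2 * t) = id := by
    rw [hxd, add_comm, Nat.add_mul_div_right _ _ (by omega), Nat.div_eq_of_lt (by omega), zero_add]
  have hy1 : id * (2 * t) + i < 2 ^ (2 * t * w) * (2 * t) := by
    have := Nat.mul_le_mul_right (2 * t) (Nat.succ_le_of_lt hidlt)
    rw [Nat.succ_mul] at this
    omega
  have hxlt : x < 2 ^ (2 * t * w) * (2 * t) * (2 * t) := by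
    have := Nat.mul_le_mul_right (2 * t) (Nat.succ_le_of_lt hy1)
    rw [Nat.succ_mul] at this
    omega
  have hM2 : 2 ^ (2 * t * w) * (2 * t) ≤ 2 ^ (2 * t * w) * (2 * t) * (2 * t) :=
    Nat.le_mul_of_pos_right _ (by omega)
  have hy2 : (id * (2 * t) + i) * (2 * t) ≤ x := by omega
  have hy3 : id * (2 * t) ≤ id * (2 * t) + i := by omega
  obtain ⟨b, hb⟩ : ∃ b, s.arr 0 (wordCount n t g + 6 + x) = b := ⟨_, rfl⟩
  have hentry := hB.table x hxlt
  rw [hb, TableEntry, hx1, hx2, hx3] at hentry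
  have hbest := hentry.2 (by omega)
  have hbj : b ≤ j := by have := hbest.2.1; omega
  have hmemS : ∀ k, i ≤ k → k < j + 1 → k ∈ S J := fun k h1 h2 =>
    hS J k (by omega) (by omega) (by omega)
  have hfinal : IsBest key (ℓ - 1) r (b + (ℓ - 1) / t * t) := by
    obtain ⟨cnt, last, hRJ⟩ := hR J
    have h1 : IsBest (fun k => key (k + (ℓ - 1) / t * t)) i (j + 1) b := by
      refine hbest.of_orderIso fun x y hx hx' hy hy' => ?_
      rw [← hid, digit_blockId (fun k _ => hval J k) (by omega),
        digit_blockId (fun k _ => hval J k) (by omega),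
        hRJ.lt_iff (hmemS x hx hx') (hmemS y hy hy')]
      rw [show J * t + x - t = x + (ℓ - 1) / t * t by omega,
        show J * t + y - t = y + (ℓ - 1) / t * t by omega]
    have h2 := h1.shift
    rwa [show i + (ℓ - 1) / t * t = ℓ - 1 by omega,
      show j + 1 + (ℓ - 1) / t * t = r by omega] at h2
  simp only [queryCmd, runs_ite, runs_seq, runs_asg]
  refine ⟨by simp, fun hne => ?_, fun _ => ?_⟩
  · simp [h0, h1] at hne
    omega
  simp only [Exp.eval, Exp.Safe, exactValue, Fits, Env.set_v, Env.set_arr, Exp.cost]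
  simp only [Nat.reduceEqDiff, if_false, if_true, h0, h1, hB.cell_zero, hB.cell_one,
    hB.cell_two, hB.cell_three, hB.cell_four, hB.cell_five, hJ, hi, hj, hword, hext, hx, hm, hb]
  simp only [true_and, and_true]
  refine ⟨by omega, by omega, by omega, by omega, by omega, by omega, by omega, by omega,
    by omega, _, hfinal, by omega⟩

/-! ### From commands to the two machine programs -/

/-- The program has no `store` instruction. -/
def noStore : Prog → Bool
  | .instr (.store _ _) => false
  | .instr _ => true
  | .seq p q => noStore p && noStore q
  | .ite _ p q => noStore p && noStore q
  | .while _ p => noStore p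

theorem mem_eq_of_noStore {W : ℕ} {p : Prog} {z z' : State} {t : ℕ} (h : Exec W p z z' t) :
    noStore p = true → z'.mem = z.mem := by
  induction h with
  | instr i s => cases i <;> simp [noStore, Instr.exec]
  | seq _ _ h1 h2 =>
    intro h
    simp only [noStore, Bool.and_eq_true] at h
    rw [h2 h.2, h1 h.1]
  | ite_nonzero _ _ h1 =>
    intro h
    simp only [noStore, Bool.and_eq_true] at h
    exact h1 h.1
  | ite_zero _ _ h1 =>
    intro h
    simp only [noStore, Bool.and_eq_true] at h
    exact h1 h.2
  | while_zero => exact fun _ => rfl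
  | while_nonzero _ _ _ h1 h2 =>
    intro h
    rw [h2 h]
    exact h1 h

/-- For the query, memory is a single array of length `size` with base address `0`, the initial
value of register `100`. Safe accesses stay below `size`, so the remaining cells may be arbitrary.
The memory is unchanged because the program never stores. -/
theorem answersMinSuf_of_runs {W size τ : ℕ} {A : ℕ → ℕ} {T : List ℕ} (hsize : size ≤ 2 ^ W)
    (h : ∀ ℓ r, 1 ≤ ℓ → ℓ ≤ r → r ≤ T.length → r - ℓ + 1 ≤ τ → ∀ M : ℕ → ℕ,
      (∀ a < size, M a = A a) →
      Runs ⟨W, 1, size⟩ queryCmd ⟨inputRegs ℓ r, fun _ => M⟩ fun s' t => t ≤ 100 ∧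
        ∃ b, IsBest (fun i => T.getD i 0) (ℓ - 1) r b ∧ s'.v 0 = r - b) {C : ℕ} (hC : 100 ≤ C) :
    AnswersMinSuf W queryCmd.compile A size T τ C := by
  intro ℓ r hℓ hℓr hr hτ M hM
  obtain ⟨s', t, he, ht, b, hb, hv⟩ := h ℓ r hℓ hℓr hr hτ M hM
  have hrepr : Represents ⟨W, 1, size⟩ ⟨inputRegs ℓ r, M⟩ ⟨inputRegs ℓ r, fun _ => M⟩ := by
    refine ⟨fun _ _ => rfl, fun k hk => ?_, fun k hk i hi => ?_⟩
    · obtain rfl : k = 0 := Nat.lt_one_iff.1 hk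
      simp [inputRegs]
    · obtain rfl : k = 0 := Nat.lt_one_iff.1 hk
      simp
  obtain ⟨z', hz, hr'⟩ := he.exec_compile (by simp) (by simpa using hsize) (by decide) _ hrepr
  obtain ⟨u, hu, hlen⟩ := hb.isMinSuf hr
  exact ⟨z', t, hz, ht.trans hC, mem_eq_of_noStore hz (by decide), u, hu, by
    rw [hr'.var 0 (by omega), hv, hlen]⟩

/-- Single letters are answered without reading any cell. This is essential for `τ < 2`, when the
data structure is empty and every access would be out of bounds. -/
theorem runs_query_of_eq {D : Dims} {s : Env} {key : ℕ → ℕ} {ℓ : ℕ} (hW : D.W ≠ 0)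
    (h0 : s.v 0 = ℓ) (h1 : s.v 1 = ℓ) (hℓ : 1 ≤ ℓ) :
    Runs D queryCmd s fun s' T => T ≤ 100 ∧ ∃ b, IsBest key (ℓ - 1) ℓ b ∧ s'.v 0 = ℓ - b := by
  simp only [queryCmd, runs_ite, runs_asg]
  refine ⟨by simp, fun _ => ⟨by simp [hW], by simp, ℓ - 1, ?_, ?_⟩, fun hz => ?_⟩
  · have := isBest_succ_self key (ℓ - 1)
    rwa [Nat.sub_add_cancel hℓ] at this
  · simp; omega
  · simp [h0, h1] at hz

/-- Store the addresses of the arrays in registers `101, …, 107`. -/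
def baseProg : Prog :=
  .seq (.instr (.op .add 101 100 0)) (.seq (.instr (.op .add 102 101 0))
  (.seq (.instr (.op .add 103 102 0)) (.seq (.instr (.op .add 104 103 0))
  (.seq (.instr (.op .add 105 104 0)) (.seq (.instr (.op .add 106 105 0))
  (.instr (.op .add 107 106 0)))))))

/-- Register `100` is initially `0` and register `0` holds `n`, so repeated addition yields the
addresses `k * n`. Array `0` is then the text in place, and the other arrays lie in cells behind it,
which are `0`. -/
theorem exec_base {W τ : ℕ} {T : List ℕ} (hW : 8 * T.length ≤ 2 ^ W) (hT : 0 < T.length) :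
    ∃ z, Exec W baseProg (buildInput T τ) z 7 ∧ Represents ⟨W, 8, T.length⟩ z
      ⟨inputRegs T.length τ, fun k i => if k = 0 then T.getD i 0 else 0⟩ := by
  refine ⟨_, .seq (.instr _ _) (.seq (.instr _ _) (.seq (.instr _ _) (.seq (.instr _ _)
    (.seq (.instr _ _) (.seq (.instr _ _) (.instr _ _)))))), ?_, ?_, ?_⟩
  · intro x hx
    simp only [Instr.exec, buildInput]
    rw [Function.update_of_ne (by omega), Function.update_of_ne (by omega),
      Function.update_of_ne (by omega), Function.update_of_ne (by omega),
      Function.update_of_ne (by omega), Function.update_of_ne (by omega),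
      Function.update_of_ne (by omega)]
  · intro k hk
    simp only at hk
    have h1 : T.length < 2 ^ W := by omega
    interval_cases k <;> simp [Instr.exec, buildInput, inputRegs, Op.eval, Nat.mod_eq_of_lt h1]
    all_goals refine (Nat.mod_eq_of_lt ?_).trans ?_ <;> omega
  · intro k hk i hi
    simp only [Instr.exec, buildInput]
    rcases Nat.eq_zero_or_pos k with rfl | hk0
    · simp
    · have : T.length ≤ k * T.length := Nat.le_mul_of_pos_left _ hk0
      rw [if_neg (by omega), List.getD_eq_default _ _ (by omega)]

/-- The construction program. -/
def buildProg : Prog := .seq baseProg buildCmd.compile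

theorem getD_lt_of_forall {T : List ℕ} {p B : ℕ} (hp : p < T.length) (h : ∀ x ∈ T, x < B) :
    T.getD p 0 < B := by
  rw [List.getD_eq_getElem _ _ hp]
  exact h _ (List.getElem_mem _)

theorem exec_build_of_runs {W τ : ℕ} {T : List ℕ} {Q : Env → ℕ → Prop}
    (hW : 8 * T.length ≤ 2 ^ W) (hT : 0 < T.length)
    (h : Runs ⟨W, 8, T.length⟩ buildCmd
      ⟨inputRegs T.length τ, fun k i => if k = 0 then T.getD i 0 else 0⟩ Q) :
    ∃ z s t, Exec W buildProg (buildInput T τ) z (7 + t) ∧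
      Represents ⟨W, 8, T.length⟩ z s ∧ Q s t := by
  obtain ⟨z, hz, hr⟩ := exec_base (τ := τ) hW hT
  obtain ⟨s, t, he, hq⟩ := h
  obtain ⟨z', hz', hr'⟩ := he.exec_compile (by simp) hW (by decide) _ hr
  exact ⟨z', s, t, .seq hz hz', hr', hq⟩

/-- For `τ < 2` no data is needed. -/
theorem exec_build_of_lt_two {W τ : ℕ} {T : List ℕ} (hW : 8 * T.length ≤ 2 ^ W)
    (hT : 0 < T.length) (hτ : τ < 2) {C : ℕ} (hC : 100 ≤ C) :
    ∃ z t, Exec W buildProg (buildInput T τ) z t ∧ t ≤ 20 ∧ z.regs 0 = 0 ∧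
      AnswersMinSuf W queryCmd.compile z.mem 0 T τ C := by
  have hW0 := wordSize_ne_zero hW hT
  obtain ⟨z, s, t, hz, hr, ht, h0⟩ := exec_build_of_runs (τ := τ)
    (Q := fun s t => t ≤ 10 ∧ s.v 0 = 0) hW hT (by
      simp only [buildCmd, runs_ite, runs_asg]
      refine ⟨⟨trivial, show 2 < 2 ^ W by omega, trivial⟩, fun _ => by simp, fun h => ?_⟩
      simp [inputRegs] at h
      omega)
  refine ⟨z, 7 + t, hz, by omega, by rw [hr.var 0 (by omega), h0], ?_⟩
  refine answersMinSuf_of_runs (by omega) ?_ hC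
  intro ℓ r hℓ hℓr hr hle M hM
  obtain rfl : ℓ = r := by omega
  exact runs_query_of_eq hW0 rfl rfl hℓ

theorem exec_build {W τ t w c : ℕ} {T : List ℕ} (hW : 8 * T.length ≤ 2 ^ W)
    (hx : ∀ x ∈ T, x < T.length ^ c ∧ x < 2 ^ W) (hτ : 2 ≤ τ) (ht : t = 2 ^ Nat.clog 2 τ)
    (hw : w = Nat.clog 2 τ + 2) (hM : (2 ^ (2 * t * w)) ^ 4 ≤ T.length) {C : ℕ} (hC : 100 ≤ C) :
    ∃ z u g, Exec W buildProg (buildInput T τ) z u ∧ u ≤ 1200 * (c + 1) * T.length ∧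
      Params T.length t w g ∧
      z.regs 0 = wordCount T.length t g + 6 + 2 ^ (2 * t * w) * (2 * t) * (2 * t) ∧
      AnswersMinSuf W queryCmd.compile z.mem (z.regs 0) T τ C := by
  have hT : 0 < T.length := lt_of_lt_of_le (by positivity) hM
  have hW0 := wordSize_ne_zero hW hT
  obtain ⟨z, s, u, hz, hr, hu, g, S, val, hP, hR, hS, hval, hB, h0⟩ :=
    exec_build_of_runs (τ := τ) hW hT (runs_build (key := fun i => T.getD i 0) (c := c) rfl hW hτ ht
      hw hM rfl rfl (by simp) (fun p hp => getD_lt_of_forall hp fun x hxT => (hx x hxT).2)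
      (fun p hp => getD_lt_of_forall hp fun x hxT => (hx x hxT).1)
      (fun k hk => by simp [show k ≠ 0 by omega]; rfl))
  have hsz := hP.size_le
  simp only at hsz
  have hz0 : z.regs 0 = wordCount T.length t g + 6 + 2 ^ (2 * t * w) * (2 * t) * (2 * t) := by
    rw [hr.var 0 (by omega), h0]
  refine ⟨z, 7 + u, g, hz, ?_, hP, hz0, ?_⟩
  · simp only at hu
    have : 1 * 1 ≤ (c + 1) * T.length := Nat.mul_le_mul (by omega) hT
    nlinarith
  rw [hz0]
  refine answersMinSuf_of_runs (by omega) ?_ hC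
  intro ℓ r hℓ hℓr hr' hle M hM'
  rcases hℓr.eq_or_lt with rfl | hlt
  · exact runs_query_of_eq hW0 rfl rfl hℓ
  · refine runs_query (n := T.length) (S := S) (val := val) rfl hW hP rfl hR hS hval ?_ rfl rfl hℓ
      hlt hr' ?_
    · refine hB.congr fun a ha => ?_
      have harr := hr.arr 0 (by simp) a (by simp only at ha ⊢; omega)
      simp only [zero_mul, zero_add] at harr
      rw [← harr]
      exact hM' a ha
    · rw [ht]
      exact hle.trans (Nat.le_pow_clog (by omega) τ)

/-! ### Asymptotics -/

theorem clog_mul_log_two_le {τ : ℕ} (hτ : 2 ≤ τ) :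
    ((Nat.clog 2 τ : ℝ) - 1) * Real.log 2 ≤ Real.log τ := by
  have h := Nat.pow_pred_clog_lt_self (b := 2) (by omega) (show 1 < τ by omega)
  have hc : 1 ≤ Nat.clog 2 τ := (Nat.lt_clog_iff_pow_lt (by omega)).2 (by simp; omega)
  have h' : ((2 : ℝ) ^ (Nat.clog 2 τ - 1)) ≤ τ := by exact_mod_cast h.le
  have := Real.log_le_log (by positivity) h'
  rw [Real.log_pow, Nat.cast_sub hc, Nat.cast_one] at this
  exact this

/-- From `(Nat.clog 2 τ - 1) * log 2 ≤ log τ`, with the three remaining summands `log 2` each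
bounded by `log τ`. -/
theorem width_mul_log_two_le {τ : ℕ} (hτ : 2 ≤ τ) :
    ((Nat.clog 2 τ + 2 : ℕ) : ℝ) * Real.log 2 ≤ 4 * Real.log τ := by
  have h1 := clog_mul_log_two_le hτ
  have h2 : Real.log 2 ≤ Real.log τ := Real.log_le_log (by norm_num) (by exact_mod_cast hτ)
  push_cast
  linarith

theorem two_pow_clog_le {τ : ℕ} (hτ : 2 ≤ τ) : 2 ^ Nat.clog 2 τ ≤ 2 * τ := by
  have h := Nat.pow_pred_clog_lt_self (b := 2) (by omega) (show 1 < τ by omega)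
  have hc : 1 ≤ Nat.clog 2 τ := (Nat.lt_clog_iff_pow_lt (by omega)).2 (by simp; omega)
  obtain ⟨e, he⟩ : ∃ e, Nat.clog 2 τ = e + 1 := ⟨Nat.clog 2 τ - 1, by omega⟩
  rw [he] at h ⊢
  simp only [Nat.pred_eq_sub_one, Nat.add_sub_cancel] at h
  rw [pow_succ]
  omega

theorem eventually_pow_le {τ : ℕ → ℕ}
    (h : Asymptotics.IsLittleO Filter.atTop (fun n : ℕ => (τ n : ℝ))
      (fun n : ℕ => Real.log n / Real.log (Real.log n))) :
    ∀ᶠ n : ℕ in Filter.atTop, 2 ≤ τ n →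
      (2 ^ (2 * 2 ^ Nat.clog 2 (τ n) * (Nat.clog 2 (τ n) + 2))) ^ 4 ≤ n := by
  have hlog : Filter.Tendsto (fun n : ℕ => Real.log n) Filter.atTop Filter.atTop :=
    Real.tendsto_log_atTop.comp tendsto_natCast_atTop_atTop
  -- With `x = log n`, the bounds `t ≤ 2 * τ` and `w * log 2 ≤ 4 * log τ ≤ 4 * log x` give `log (M ^
  -- 4) = 8 * t * (w * log 2) ≤ 64 * τ * log x`. The constant `1 / 64` makes this at most `x`. The
  -- condition `exp 1 ≤ log n` ensures `log x ≥ 1`, so that `τ ≤ x`.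
  filter_upwards [h.def (show (0 : ℝ) < 1 / 64 by norm_num),
    hlog.eventually_ge_atTop (Real.exp 1), Filter.eventually_ge_atTop 1] with n hn hlogn hn1 hτ
  set x := Real.log n with hx
  have hx0 : 0 < x := (Real.exp_pos 1).trans_le hlogn
  have hlx : 1 ≤ Real.log x := (Real.le_log_iff_exp_le hx0).2 hlogn
  rw [Real.norm_of_nonneg (by positivity), Real.norm_of_nonneg (by positivity)] at hn
  have hτ0 : (0 : ℝ) < τ n := by exact_mod_cast (show 0 < τ n by omega)
  have h1 : (τ n : ℝ) * Real.log x ≤ x / 64 := by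
    have := mul_le_mul_of_nonneg_right hn (show 0 ≤ Real.log x by linarith)
    calc _ ≤ _ := this
      _ = x / 64 := by field_simp
  have h2 : (τ n : ℝ) ≤ x := by nlinarith
  have h3 : Real.log (τ n) ≤ Real.log x := Real.log_le_log hτ0 h2
  have h4 := width_mul_log_two_le hτ
  have h5 : ((2 ^ Nat.clog 2 (τ n) : ℕ) : ℝ) ≤ 2 * τ n := by exact_mod_cast two_pow_clog_le hτ
  set t := 2 ^ Nat.clog 2 (τ n)
  set w := Nat.clog 2 (τ n) + 2
  have h6 : ((2 * t * w * 4 : ℕ) : ℝ) * Real.log 2 ≤ x := by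
    have h7 : (t : ℝ) * (w * Real.log 2) ≤ (2 * τ n) * (4 * Real.log (τ n)) := by
      have : 0 ≤ (w : ℝ) * Real.log 2 := by positivity
      exact mul_le_mul h5 h4 this (by positivity)
    have h8 : (τ n : ℝ) * Real.log (τ n) ≤ τ n * Real.log x := by gcongr
    push_cast
    nlinarith
  rw [← pow_mul]
  have hn0 : (0 : ℝ) < n := by exact_mod_cast hn1
  have h9 : ((2 : ℝ) ^ (2 * t * w * 4)) ≤ n := by
    rw [← Real.log_le_log_iff (by positivity) hn0, Real.log_pow]
    exact h6
  exact_mod_cast h9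

theorem Params.cast_size_le {n t w g τ : ℕ} (h : Params n t w g) (hτ : 2 ≤ τ)
    (hw : w = Nat.clog 2 τ + 2) :
    ((wordCount n t g + 6 + 2 ^ (2 * t * w) * (2 * t) * (2 * t) : ℕ) : ℝ) ≤
      40 * (n * Real.log τ / Real.log n) := by
  have ht2 := h.two_le
  have htn := h.t_lt
  have hg := h.g_pos
  have hn0 : (0 : ℝ) < n := by exact_mod_cast (show 0 < n by omega)
  have hlogn : 0 < Real.log n := Real.log_pos (by exact_mod_cast (show 1 < n by omega))
  have hl2 : Real.log 2 ≤ Real.log τ := Real.log_le_log (by norm_num) (by exact_mod_cast hτ)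
  have hl2' : (1 : ℝ) / 2 ≤ Real.log 2 := by have := Real.log_two_gt_d9; linarith
  set Y : ℝ := n * Real.log τ / Real.log n with hY
  have ht0 : (0 : ℝ) < t := by exact_mod_cast (show 0 < t by omega)
  have hg0 : (0 : ℝ) < g := by exact_mod_cast hg
  have hwl : (w : ℝ) * Real.log 2 ≤ 4 * Real.log τ := by rw [hw]; exact width_mul_log_two_le hτ
  have hwords : (wordCount n t g : ℝ) ≤ 16 * Y + 2 := by
    have h1 : (wordCount n t g : ℝ) ≤ (n / t + 1) / g + 1 := by
      unfold wordCount
      push_cast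
      gcongr
      refine Nat.cast_div_le.trans ?_
      gcongr
      push_cast
      gcongr
      exact Nat.cast_div_le
    have h2 : (n / t + 1 : ℝ) / g ≤ n / (t * g) + 1 := by
      rw [add_div, div_div]
      have : (1 : ℝ) / g ≤ 1 := by
        rw [div_le_one hg0]; exact_mod_cast hg
      linarith
    -- The maximality of `g` enters here: `n < M ^ (g + 1)`, and `g + 1 ≤ 2 * g`.
    have h3 : Real.log n ≤ 4 * t * g * (w * Real.log 2) := by
      have h4 : (n : ℝ) ≤ 2 ^ (2 * t * w * (g + 1)) := by
        have := h.lt.le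
        rw [← pow_mul] at this
        exact_mod_cast this
      have h5 := Real.log_le_log hn0 h4
      rw [Real.log_pow] at h5
      push_cast at h5
      have h6 : (1 : ℝ) ≤ g := by exact_mod_cast hg
      have h7 : (0 : ℝ) ≤ t * (w * Real.log 2) := by positivity
      nlinarith
    have h8 : (n : ℝ) / (t * g) ≤ 16 * Y := by
      rw [hY, div_le_iff₀ (by positivity), mul_div_assoc', div_mul_eq_mul_div,
        le_div_iff₀ hlogn]
      calc (n : ℝ) * Real.log n ≤ n * (4 * t * g * (w * Real.log 2)) := by gcongr
        _ ≤ n * (4 * t * g * (4 * Real.log τ)) := by gcongr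
        _ = _ := by ring
    linarith
  -- The table is of lower order: `M ^ 2 ≤ √n`, while `log n ≤ 2 * √n` and `log τ ≥ 1 / 2` give `√n
  -- ≤ 4 * Y`.
  have hsq : ((2 ^ (2 * t * w)) ^ 2 : ℝ) ≤ 4 * Y := by
    have h1 : ((2 ^ (2 * t * w)) ^ 2 : ℝ) ≤ √n := by
      apply Real.le_sqrt_of_sq_le
      rw [← pow_mul (2 ^ (2 * t * w) : ℝ)]
      exact_mod_cast h.pow_four_le
    have h2 : Real.log n ≤ 2 * √n := by
      have h3 := Real.log_sqrt hn0.le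
      have h4 := Real.log_le_sub_one_of_pos (Real.sqrt_pos.2 hn0)
      linarith
    have h3 : √(n : ℝ) * √n = n := Real.mul_self_sqrt hn0.le
    have h4 : √(n : ℝ) ≤ 4 * Y := by
      rw [hY, mul_div_assoc', le_div_iff₀ hlogn]
      have h5 : √(n : ℝ) * Real.log n ≤ √n * (2 * √n) := by gcongr
      have h6 : (n : ℝ) * (1 / 2) ≤ n * Real.log τ := by gcongr; linarith
      nlinarith
    linarith
  have htab : ((2 ^ (2 * t * w) * (2 * t) * (2 * t) : ℕ) : ℝ) ≤ (2 ^ (2 * t * w)) ^ 2 := by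
    have := le_trans (Nat.le_mul_of_pos_right _ (by positivity)) h.table_le
    exact_mod_cast this
  have hbig : (8 : ℝ) ≤ (2 ^ (2 * t * w)) ^ 2 := by
    have h1 : 8 ≤ 2 ^ (2 * t * w) := by
      have h2 := h.pow_le
      have h3 : 4 * t ≤ (4 * t) ^ 4 := Nat.le_self_pow (by omega) _
      omega
    have h4 : (8 : ℝ) ≤ 2 ^ (2 * t * w) := by exact_mod_cast h1
    nlinarith
  push_cast at htab ⊢
  linarith

end ArrayLang

/-! ### The theorem -/

theorem mainTheorem7 :
    ∃ (build query : WordRAM.Prog) (K : ℕ), ∀ c : ℕ, ∃ C : ℕ, ∀ τ : ℕ → ℕ,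
      Asymptotics.IsLittleO Filter.atTop (fun n : ℕ => (τ n : ℝ))
        (fun n : ℕ => Real.log n / Real.log (Real.log n)) →
      ∃ n₀ : ℕ, ∀ n : ℕ, n₀ ≤ n → ∀ W : ℕ, K * n ≤ 2 ^ W →
        ∀ T : List ℕ, T.length = n → (∀ x ∈ T, x < n ^ c ∧ x < 2 ^ W) →
          ∃ (D : WordRAM.State) (t : ℕ),
            WordRAM.Exec W build (WordRAM.buildInput T (τ n)) D t ∧
            t ≤ C * n ∧
            (D.regs 0 : ℝ) ≤ C * (n * Real.log (τ n) / Real.log n) ∧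
            AnswersMinSuf W query D.mem (D.regs 0) T (τ n) C := by
  -- The construction uses eight arrays of length `n`, all of whose addresses must be words; hence
  -- `K = 8`. The constant `1200 * (c + 1)` is that of the construction time, and it exceeds the
  -- constant `40` for the size and the bound `100` for the query time.
  refine ⟨ArrayLang.buildProg, ArrayLang.queryCmd.compile, 8, fun c => ⟨1200 * (c + 1),
    fun τ hτ => ?_⟩⟩
  obtain ⟨n₀, hn₀⟩ := Filter.eventually_atTop.1 (ArrayLang.eventually_pow_le hτ)
  refine ⟨max n₀ 1, fun n hn W hW T hT hx => ?_⟩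
  subst hT
  have hpos : 0 < T.length := lt_of_lt_of_le Nat.one_pos ((le_max_right _ _).trans hn)
  have hnonneg : (0 : ℝ) ≤ T.length * Real.log (τ T.length) / Real.log T.length :=
    div_nonneg (mul_nonneg (Nat.cast_nonneg _) (Real.log_natCast_nonneg _))
      (Real.log_natCast_nonneg _)
  rcases Nat.lt_or_ge (τ T.length) 2 with h2 | h2
  · obtain ⟨z, t, hz, ht, h0, hA⟩ := ArrayLang.exec_build_of_lt_two hW hpos h2
      (C := 1200 * (c + 1)) (by omega)
    refine ⟨z, t, hz, ?_, ?_, by rwa [h0]⟩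
    · have : 1200 * 1 * 1 ≤ 1200 * (c + 1) * T.length :=
        Nat.mul_le_mul (Nat.mul_le_mul_left _ (by omega)) hpos
      omega
    · rw [h0, Nat.cast_zero]
      positivity
  · obtain ⟨z, t, g, hz, ht, hP, h0, hA⟩ := ArrayLang.exec_build hW hx h2 rfl rfl
      (hn₀ _ ((le_max_left _ _).trans hn) h2) (C := 1200 * (c + 1)) (by omega)
    refine ⟨z, t, hz, ht, ?_, hA⟩
    rw [h0]
    refine (hP.cast_size_le h2 rfl).trans (mul_le_mul_of_nonneg_right ?_ hnonneg)
    push_cast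
    have : (0 : ℝ) ≤ c := Nat.cast_nonneg _
    linarith
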